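/- **Setting.** Let $V=V_{\bar 0}\oplus V_{\bar 1}$ be a vertex algebra over $\mathbb C$ (super case included) with vacuum $|0\rangle$, translation operator $Ta=a_{(-2)}|0\rangle$ and vertex operators $Y(a,z)=\sum_{n\in\mathbb Z}a_{(n)}z^{-n-1}$. Let $H$ be a Hamiltonian operator, i.e. an even diagonalizable operator on $V$ with $[H,Y(a,z)]=z\partial_zY(a,z)+Y(Ha,z)$; if $Ha=\Delta a$ write $\Delta_a=\Delta$. Put $p(a,b)=(-1)^{p(a)p(b)}$ for vectors of parities $p(a),p(b)$. For an eigenvector $a$ of $H$ and $b\in V$ define $$a_{(n,\hbar)}b=\sum_{j\ge 0}\binom{\Delta_a}{j}\hbar^j a_{(n+j)}b\in V[\hbar],\qquad [a,b]_\hbar=\sum_{j\ge0}(-\hbar)^j a_{(j,\hbar)}b ,$$ extend linearly to $a\in V$ and $\mathbb C[\hbar]$-bilinearly to $V[\hbar]$. Let $J_\hbar\subset V[\hbar]$ be the $\mathbb C[\hbar]$-span of all $a_{(-2,\hbar)}b$ with $a,b\in V$. **Part 1.** (a) $a_{(-j,\hbar)}b\in J_\hbar$ for all $j\ge2$, $a,b\in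 V$. (b) $(T+\hbar H)V\subset J_\hbar$. (c) $J_\hbar$ is a two-sided ideal of $V[\hbar]$ for the $(-1,\hbar)$-product. (d) $J_\hbar$ is a two-sided ideal of $V[\hbar]$ for the bracket $\hbar[\cdot,\cdot]_\hbar$. (e) $|0\rangle$ is a two-sided identity element for the $(-1,\hbar)$-product. (f) $a_{(-1,\hbar)}b-p(a,b)\,b_{(-1,\hbar)}a-\hbar[a,b]_\hbar\in J_\hbar$ for parity-homogeneous $a,b\in V[\hbar]$. (g) $(a_{(-1,\hbar)}b)_{(-1,\hbar)}c-a_{(-1,\hbar)}(b_{(-1,\hbar)}c)\in J_\hbar$ for all $a,b,c\in V[\hbar]$. Consequently $Zhu_{\hbar,H}V=V[\hbar]/J_\hbar$, with the product induced by the $(-1,\hbar)$-product, the image of $|0\rangle$ as unit and the induced parity, is a unital associative superalgebra over $\mathbb C[\hbar]$. **Part 2.** Assume moreover that the eigenvalues of $H$ are real. Let $\Gamma$ be an additive subgroup of $\mathbb R$ containing $\mathbb Z$, and let $V=\bigoplus_{\bar\gamma\in\Gamma/\mathbb Z}{}^{\bar\gamma}V$ be a decomposition into sub-superspaces with ${}^{\bar\alpha}V_{(n)}{}^{\bar\beta}V\subset{}^{\bar\alpha+\bar\beta}V$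 and $H({}^{\bar\gamma}V)\subset{}^{\bar\gamma}V$. For $a\in{}^{\bar\gamma}V$ with $Ha=\Delta_a a$ ("homogeneous") let $\epsilon_a$ be the largest non-positive real number in the coset $\bar\gamma-\Delta_a+\mathbb Z$, and let $\gamma_a=\Delta_a+\epsilon_a$. Let $\chi(a,b)=1$ if $\epsilon_a+\epsilon_b\le-1$ and $\chi(a,b)=0$ otherwise. Define $$a_{(n,\hbar,\Gamma)}b=\sum_{j\ge0}\binom{\gamma_a}{j}\hbar^ja_{(n+j)}b,\qquad [a,b]_{\hbar,\Gamma}=\sum_{j\ge0}(-\hbar)^ja_{(j,\hbar,\Gamma)}b ,$$ extended (bi)linearly as before. Let $V_{\hbar,\Gamma}\subset V[\hbar]$ be the $\mathbb C[\hbar]$-span of the homogeneous $a\in V$ with $\epsilon_a=0$, and let $J_{\hbar,\Gamma}$ be the $\mathbb C[\hbar]$-span of all $a_{(-2+\chi(a,b),\hbar,\Gamma)}b$ with $a,b\in V$ homogeneous and $\epsilon_a+\epsilon_b\in\mathbb Z$. Then $J_{\hbar,\Gamma}\subset V_{\hbar,\Gamma}$ and $|0\rangle\in V_{\hbar,\Gamma}$;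 $V_{\hbar,\Gamma}$ is closed under the $(-1,\hbar,\Gamma)$-product, which coincides on it with the $(-1,\hbar)$-product, and under $[\cdot,\cdot]_{\hbar,\Gamma}$; and: (a) $a_{(-j+\chi(a,b),\hbar,\Gamma)}b\in J_{\hbar,\Gamma}$ for all $j\ge2$ and homogeneous $a,b\in V$ with $\epsilon_a+\epsilon_b\in\mathbb Z$. (b) $(T+\hbar H)V_{\hbar,\Gamma}\subset J_{\hbar,\Gamma}$. (c) $J_{\hbar,\Gamma}$ is a two-sided ideal of $V_{\hbar,\Gamma}$ for the $(-1,\hbar,\Gamma)$-product. (d) $J_{\hbar,\Gamma}$ is a two-sided ideal of $V_{\hbar,\Gamma}$ for the bracket $\hbar[\cdot,\cdot]_{\hbar,\Gamma}$. (e) $|0\rangle$ is a two-sided identity element for the $(-1,\hbar,\Gamma)$-product on $V[\hbar]$. (f) $a_{(-1,\hbar,\Gamma)}b-p(a,b)\,b_{(-1,\hbar,\Gamma)}a\equiv(1-\chi(a,b))\,\hbar[a,b]_{\hbar,\Gamma}\bmod J_{\hbar,\Gamma}$ for homogeneous and parity-homogeneous $a,b\in V$ with $\epsilon_a+\epsilon_b\in\mathbb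 Z$. (g) The $(-1,\hbar,\Gamma)$-product is associative on $V_{\hbar,\Gamma}$ modulo $J_{\hbar,\Gamma}$. Consequently $Zhu_{\hbar,\Gamma}V=V_{\hbar,\Gamma}/J_{\hbar,\Gamma}$, with the product induced by the $(-1,\hbar,\Gamma)$-product, the image of $|0\rangle$ as unit and the induced parity, is a unital associative superalgebra over $\mathbb C[\hbar]$. -/

import Mathlib

open scoped TensorProduct Polynomial DirectSum

universe u v

namespace ZhuAlg

noncomputable section

/-! ### Linear algebra -/

section LinearAlgebra

variable {V : Type u} [AddCommGroup V] [Module ℂ V]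

/-- The linear map on `V = ⨁ 𝒜 i` which coincides with `F i` on each summand `𝒜 i`
(extension by linearity of an expression that makes sense for homogeneous vectors). -/
def extend {ι : Type*} [DecidableEq ι] {W : Type*} [AddCommMonoid W] [Module ℂ W]
    (𝒜 : ι → Submodule ℂ V) (h : DirectSum.IsInternal 𝒜) (F : ι → V →ₗ[ℂ] W) : V →ₗ[ℂ] W :=
  (DirectSum.toModule ℂ ι W fun i => F i ∘ₗ (𝒜 i).subtype) ∘ₗ
    (LinearEquiv.ofBijective (DirectSum.coeLinearMap 𝒜)
      (show Function.Bijective (DirectSum.coeLinearMap 𝒜) from h)).symm.toLinearMap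

theorem extend_of_mem {ι : Type*} [DecidableEq ι] {W : Type*} [AddCommMonoid W] [Module ℂ W]
    (𝒜 : ι → Submodule ℂ V) (h : DirectSum.IsInternal 𝒜) (F : ι → V →ₗ[ℂ] W)
    {i : ι} {a : V} (ha : a ∈ 𝒜 i) : extend 𝒜 h F a = F i a := by
  have h1 : (LinearEquiv.ofBijective (DirectSum.coeLinearMap 𝒜)
      (show Function.Bijective (DirectSum.coeLinearMap 𝒜) from h)).symm a
      = DirectSum.lof ℂ ι (fun i => 𝒜 i) i ⟨a, ha⟩ := by
    rw [LinearEquiv.symm_apply_eq, LinearEquiv.ofBijective_apply, DirectSum.coeLinearMap_lof]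
  simp [extend, h1]

/-- The bilinear map `(a, b) ↦ ∑ j, P j a b`, when each of these sums is finite. -/
def sumBilin {W : Type*} [AddCommGroup W] [Module ℂ W] (P : ℕ → V →ₗ[ℂ] V →ₗ[ℂ] W)
    (hP : ∀ a b, {j | P j a b ≠ 0}.Finite) : V →ₗ[ℂ] V →ₗ[ℂ] W :=
  LinearMap.mk₂ ℂ (fun a b => ∑ᶠ j, P j a b)
    (fun a a' b => by
      simp only [map_add, LinearMap.add_apply]
      exact finsum_add_distrib (hP a b) (hP a' b))
    (fun c a b => by
      simp only [map_smul, LinearMap.smul_apply]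
      exact (smul_finsum c _).symm)
    (fun a b b' => by
      simp only [map_add]
      exact finsum_add_distrib (hP a b) (hP a b'))
    (fun c a b => by
      simp only [map_smul]
      exact (smul_finsum c _).symm)

variable (V) in
/-- `V[ħ]`, as the `ℂ[ħ]`-module `ℂ[ħ] ⊗ V`; the polynomial variable is `ħ`. -/
abbrev Hb : Type u := ℂ[X] ⊗[ℂ] V

/-- The usual additive group structure (a shortcut for instance search). -/
instance : AddCommGroup (Hb V) := TensorProduct.addCommGroup

/-- The inclusion of `V` in `V[ħ]`. -/
def incl : V →ₗ[ℂ] Hb V := TensorProduct.mk ℂ ℂ[X] V 1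

/-- The `ℂ[ħ]`-bilinear extension to `V[ħ]` of a `ℂ`-bilinear map on `V` with values in `V[ħ]`. -/
def bilinExt (B : V →ₗ[ℂ] V →ₗ[ℂ] Hb V) : Hb V →ₗ[ℂ[X]] Hb V →ₗ[ℂ[X]] Hb V :=
  LinearMap.liftBaseChange ℂ[X]
    (((LinearMap.liftBaseChangeEquiv (R := ℂ) (M := V) (N := Hb V) ℂ[X]).toLinearMap.restrictScalars
      ℂ) ∘ₗ B)

theorem bilinExt_incl (B : V →ₗ[ℂ] V →ₗ[ℂ] Hb V) (a b : V) :
    bilinExt B (incl a) (incl b) = B a b := by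
  simp [bilinExt, incl]

/-- The sign `(-1)^{αβ}`. -/
def sgn (α β : ZMod 2) : ℂ := if α = 1 ∧ β = 1 then -1 else 1

end LinearAlgebra

/-! ### Vertex algebras -/

section VertexAlgebra

variable {V : Type u} [AddCommGroup V] [Module ℂ V]

/-- The `n`-th product `a_(n) b`, where `Y(a,z) = ∑ a_(n) z^{-n-1}`. -/
def nthProduct (Y : V →ₗ[ℂ] VertexOperator ℂ V) (n : ℤ) : V →ₗ[ℂ] V →ₗ[ℂ] V :=
  LinearMap.proj n ∘ₗ VertexOperator.ncoeff ∘ₗ Y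

theorem nthProduct_finite (Y : V →ₗ[ℂ] VertexOperator ℂ V) (n : ℤ) (a b : V) :
    {j : ℕ | nthProduct Y (n + j) a b ≠ 0}.Finite := by
  refine (Set.finite_lt_nat
    (-n - 1 - HahnSeries.order ((HahnModule.of ℂ).symm (Y a b)) + 1).toNat).subset ?_
  intro j hj
  by_contra hlt
  apply hj
  refine VertexOperator.ncoeff_eq_zero_of_lt_order (Y a) (n + j) b ?_
  simp only [Set.mem_ofPred_eq, not_lt] at hlt
  omega

variable (V) in
/-- A vertex algebra (vertex superalgebra) over `ℂ`: a superspace `V` with a vacuum vector and a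
parity preserving linear map `Y` from `V` to the quantum fields, satisfying the vacuum identities
and the Borcherds identity. -/
structure VertexAlgebra where
  /-- the even part `parity 0` and the odd part `parity 1` of `V` -/
  parity : ZMod 2 → Submodule ℂ V
  parity_internal : DirectSum.IsInternal parity
  vac : V
  vac_even : vac ∈ parity 0
  Y : V →ₗ[ℂ] VertexOperator ℂ V
  parity_preserving : ∀ (n : ℤ) {α β : ZMod 2} {a b : V}, a ∈ parity α → b ∈ parity β →
    nthProduct Y n a b ∈ parity (α + β)
  vac_left : ∀ (n : ℤ) (a : V), nthProduct Y n vac a = if n = -1 then a else 0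
  vac_right : ∀ (n : ℤ) (a : V), -1 ≤ n → nthProduct Y n a vac = if n = -1 then a else 0
  borcherds : ∀ (m n k : ℤ) {α β : ZMod 2} {a b : V} (c : V), a ∈ parity α → b ∈ parity β →
    ∑ᶠ j : ℕ, ((-1 : ℂ) ^ j * (Ring.choose n j : ℂ)) •
      (nthProduct Y (m + n - j) a (nthProduct Y (k + j) b c)
        - ((-1 : ℂ) ^ n * sgn α β) • nthProduct Y (n + k - j) b (nthProduct Y (m + j) a c))
    = ∑ᶠ j : ℕ, (Ring.choose m j : ℂ) •
      nthProduct Y (m + k - j) (nthProduct Y (n + j) a b) c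

namespace VertexAlgebra

variable (A : VertexAlgebra V)

/-- `a_(n) b`. -/
def nth (n : ℤ) : V →ₗ[ℂ] V →ₗ[ℂ] V := nthProduct A.Y n

/-- The infinitesimal translation operator `T a = a_(-2) |0⟩`. -/
def T : V →ₗ[ℂ] V := (A.nth (-2)).flip A.vac

/-- `V_α[ħ]`, as a subspace of `V[ħ]`. -/
def parityHb (α : ZMod 2) : Submodule ℂ[X] (Hb V) := (A.parity α).baseChange ℂ[X]

/-- `S` is a sub-superspace of `V`: it is spanned by its even and its odd vectors. -/
def IsSubSuperspace (S : Submodule ℂ V) : Prop := S ≤ ⨆ α, S ⊓ A.parity α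

/-- The coefficient of `z^{-n-1}` in `(∑ j, c j ħ^j z^j) Y(a,z) b`, i.e.
`∑ j, c j ħ^j a_(n+j) b`. -/
def seriesProd (c : ℕ → ℂ) (n : ℤ) : V →ₗ[ℂ] V →ₗ[ℂ] Hb V :=
  sumBilin
    (fun j => (A.nth (n + j)).compr₂ (c j • TensorProduct.mk ℂ ℂ[X] V (Polynomial.X ^ j)))
    (fun a b => (nthProduct_finite A.Y n a b).subset fun j hj h0 => hj (by
      have h0' : A.nth (n + j) a b = 0 := h0
      simp [h0']))

theorem seriesProd_apply (c : ℕ → ℂ) (n : ℤ) (a b : V) :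
    A.seriesProd c n a b
      = ∑ᶠ j : ℕ, c j • ((Polynomial.X ^ j : ℂ[X]) ⊗ₜ[ℂ] A.nth (n + j) a b) := rfl

theorem seriesProd_eventually_zero (a b : V) :
    ∃ N : ℕ, ∀ (c : ℕ → ℂ) (j : ℕ), N ≤ j → A.seriesProd c j a b = 0 := by
  obtain ⟨N, hN⟩ := (nthProduct_finite A.Y 0 a b).bddAbove
  refine ⟨N + 1, fun c j hj => ?_⟩
  rw [seriesProd_apply]
  refine finsum_eq_zero_of_forall_eq_zero fun i => ?_
  have : A.nth ((j : ℤ) + i) a b = 0 := by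
    by_contra hne
    have : j + i ≤ N := hN (by
      simp only [Set.mem_ofPred_eq, zero_add, Nat.cast_add]
      exact hne)
    omega
  simp [this]

/-- `Y_g(a,z) b = (1 + ħ z)^g Y(a,z) b`: the coefficient of `z^{-n-1}`, i.e.
`∑ j, binom(g, j) ħ^j a_(n+j) b`. -/
def powProd (g : ℂ) (n : ℤ) : V →ₗ[ℂ] V →ₗ[ℂ] Hb V := A.seriesProd (fun j => Ring.choose g j) n

end VertexAlgebra

/-- The bracket `∑ j, (-ħ)^j P_j(a, b)` attached to a family of products `P_n`. -/
def bracketOf (P : ℤ → V →ₗ[ℂ] V →ₗ[ℂ] Hb V)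
    (hP : ∀ a b, ∃ N : ℕ, ∀ j : ℕ, N ≤ j → P j a b = 0) : V →ₗ[ℂ] V →ₗ[ℂ] Hb V :=
  sumBilin
    (fun j => (P j).compr₂ (Algebra.lsmul ℂ ℂ (Hb V) ((-Polynomial.X : ℂ[X]) ^ j)))
    (fun a b => by
      obtain ⟨N, hN⟩ := hP a b
      refine (Set.finite_lt_nat N).subset fun j hj => ?_
      by_contra hlt
      exact hj (by simp [hN j (not_lt.mp hlt)]))

theorem bracketOf_apply (P : ℤ → V →ₗ[ℂ] V →ₗ[ℂ] Hb V)
    (hP : ∀ a b, ∃ N : ℕ, ∀ j : ℕ, N ≤ j → P j a b = 0) (a b : V) :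
    bracketOf P hP a b = ∑ᶠ j : ℕ, ((-Polynomial.X : ℂ[X]) ^ j) • P j a b := rfl

theorem extend_eventually_zero {ι : Type*} [DecidableEq ι]
    (𝒜 : ι → Submodule ℂ V) (h : DirectSum.IsInternal 𝒜)
    (F : ℤ → ι → V →ₗ[ℂ] V →ₗ[ℂ] Hb V)
    (hF : ∀ i a b, ∃ N : ℕ, ∀ j : ℕ, N ≤ j → F j i a b = 0) (a b : V) :
    ∃ N : ℕ, ∀ j : ℕ, N ≤ j → extend 𝒜 h (F j) a b = 0 := by
  have ha : a ∈ ⨆ i, 𝒜 i := h.submodule_iSup_eq_top ▸ Submodule.mem_top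
  induction ha using Submodule.iSup_induction' with
  | mem i x hx =>
    obtain ⟨N, hN⟩ := hF i x b
    exact ⟨N, fun j hj => by rw [extend_of_mem 𝒜 h _ hx, hN j hj]⟩
  | zero => exact ⟨0, fun j _ => by simp⟩
  | add x y _ _ hx hy =>
    obtain ⟨N, hN⟩ := hx
    obtain ⟨M, hM⟩ := hy
    exact ⟨max N M, fun j hj => by
      rw [map_add, LinearMap.add_apply, hN j (le_of_max_le_left hj),
        hM j (le_of_max_le_right hj), add_zero]⟩

/-! ### Hamiltonian operators and the `ħ`-deformation -/

/-- A Hamiltonian operator on a vertex algebra: an even diagonalizable operator `H` such that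
`[H, Y(a,z)] = z ∂_z Y(a,z) + Y(Ha,z)`. -/
structure Hamiltonian (A : VertexAlgebra V) where
  H : Module.End ℂ V
  even : ∀ {α : ZMod 2} {a : V}, a ∈ A.parity α → H a ∈ A.parity α
  diagonalizable : DirectSum.IsInternal fun Δ : ℂ => H.eigenspace Δ
  commutator : ∀ (n : ℤ) (a b : V),
    H (A.nth n a b) - A.nth n a (H b) = (-(n : ℂ) - 1) • A.nth n a b + A.nth n (H a) b

namespace Hamiltonian

variable {A : VertexAlgebra V} (K : Hamiltonian A)

/-- The operator `T + ħH` on `V[ħ]`. -/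
def TH : Hb V →ₗ[ℂ[X]] Hb V :=
  A.T.baseChange ℂ[X] + (Polynomial.X : ℂ[X]) • LinearMap.baseChange ℂ[X] K.H

/-- `a_(n,ħ) b` for `a, b ∈ V`: the coefficient of `z^{-n-1}` in `(1 + ħ z)^{Δ_a} Y(a,z) b`. -/
def prodV (n : ℤ) : V →ₗ[ℂ] V →ₗ[ℂ] Hb V :=
  extend (fun Δ : ℂ => K.H.eigenspace Δ) K.diagonalizable fun Δ => A.powProd Δ n

theorem prodV_eventually_zero (a b : V) :
    ∃ N : ℕ, ∀ j : ℕ, N ≤ j → K.prodV j a b = 0 :=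
  extend_eventually_zero _ K.diagonalizable (fun n Δ => A.powProd Δ n)
    (fun _ a b => (A.seriesProd_eventually_zero a b).imp fun _ hN => hN _) a b

/-- The `(n,ħ)`-product on `V[ħ]`. -/
def prod (n : ℤ) : Hb V →ₗ[ℂ[X]] Hb V →ₗ[ℂ[X]] Hb V := bilinExt (K.prodV n)

/-- The bracket `[a,b]_ħ = ∑ j, (-ħ)^j a_(j,ħ) b` on `V[ħ]`. -/
def bracket : Hb V →ₗ[ℂ[X]] Hb V →ₗ[ℂ[X]] Hb V :=
  bilinExt (bracketOf K.prodV K.prodV_eventually_zero)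

/-- `J_ħ`: the `ℂ[ħ]`-span of the elements `a_(-2,ħ) b`, `a, b ∈ V`. -/
def J : Submodule ℂ[X] (Hb V) :=
  Submodule.span ℂ[X] {x | ∃ a b : V, x = K.prod (-2) (incl a) (incl b)}

/-- The quotient `V[ħ] / J_ħ`. -/
abbrev Zhu : Type u := Hb V ⧸ K.J

end Hamiltonian

/-! ### `Γ/ℤ`-gradings and the `(ħ,Γ)`-deformation -/

/-- The group `Γ/ℤ`, for a subgroup `Γ` of `ℝ` that contains `ℤ`. -/
abbrev ModZ (Γ : AddSubgroup ℝ) : Type := Γ ⧸ (AddSubgroup.zmultiples (1 : ℝ)).addSubgroupOf Γ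

/-- The largest non-positive real number in the coset `γ - Δ + ℤ`. -/
def eps {Γ : AddSubgroup ℝ} (γ : ModZ Γ) (Δ : ℝ) : ℝ :=
  sSup {x : ℝ | x ≤ 0 ∧ ∃ g : Γ, (QuotientAddGroup.mk g : ModZ Γ) = γ ∧ x = g - Δ}

theorem isGreatest_eps {Γ : AddSubgroup ℝ} (hΓ : AddSubgroup.zmultiples (1 : ℝ) ≤ Γ)
    (γ : ModZ Γ) (Δ : ℝ) :
    IsGreatest {x : ℝ | x ≤ 0 ∧ ∃ g : Γ, (QuotientAddGroup.mk g : ModZ Γ) = γ ∧ x = g - Δ}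
      (eps γ Δ) := by
  obtain ⟨r, rfl⟩ := QuotientAddGroup.mk_surjective γ
  have key : IsGreatest {x : ℝ | x ≤ 0 ∧ ∃ g : Γ,
      (QuotientAddGroup.mk g : ModZ Γ) = QuotientAddGroup.mk r ∧ x = g - Δ}
      ((r : ℝ) - Δ - ⌈(r : ℝ) - Δ⌉) := by
    have hint : ∀ k : ℤ, (k : ℝ) ∈ AddSubgroup.zmultiples (1 : ℝ) := fun k =>
      AddSubgroup.mem_zmultiples_iff.mpr ⟨k, by simp⟩
    refine ⟨⟨by linarith [Int.le_ceil ((r : ℝ) - Δ)], r - ⟨_, hΓ (hint ⌈(r : ℝ) - Δ⌉)⟩, ?_, ?_⟩, ?_⟩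
    · rw [QuotientAddGroup.eq]
      rw [AddSubgroup.mem_addSubgroupOf]
      convert hint ⌈(r : ℝ) - Δ⌉ using 1
      simp
    · simp only [AddSubgroup.coe_sub]
      ring
    · rintro x ⟨hx0, g, hg, rfl⟩
      rw [QuotientAddGroup.eq, AddSubgroup.mem_addSubgroupOf] at hg
      obtain ⟨k, hk⟩ := AddSubgroup.mem_zmultiples_iff.mp hg
      simp only [zsmul_eq_mul, mul_one, AddSubgroup.coe_add, NegMemClass.coe_neg] at hk
      have h1 : (r : ℝ) - Δ ≤ (k : ℝ) := by linarith
      have h2 : (⌈(r : ℝ) - Δ⌉ : ℝ) ≤ k := by exact_mod_cast Int.ceil_le.mpr h1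
      linarith
  unfold eps
  rw [key.csSup_eq]
  exact key

/-- `χ = 1` if `ε₁ + ε₂ ≤ -1`, and `χ = 0` otherwise. -/
def chi (ε₁ ε₂ : ℝ) : ℤ := if ε₁ + ε₂ ≤ -1 then 1 else 0

open scoped Classical in
/-- A `Γ/ℤ`-grading of a vertex algebra with a Hamiltonian operator (with real eigenvalues),
where `Γ` is a subgroup of `ℝ` that contains `ℤ`. -/
structure TwistGrading {A : VertexAlgebra V} (K : Hamiltonian A) (Γ : AddSubgroup ℝ) where
  int_le : AddSubgroup.zmultiples (1 : ℝ) ≤ Γ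
  piece : ModZ Γ → Submodule ℂ V
  super : ∀ γ, A.IsSubSuperspace (piece γ)
  internal : DirectSum.IsInternal piece
  nth_mem : ∀ (n : ℤ) {α β : ModZ Γ} {a b : V}, a ∈ piece α → b ∈ piece β →
    A.nth n a b ∈ piece (α + β)
  H_mem : ∀ {γ : ModZ Γ} {a : V}, a ∈ piece γ → K.H a ∈ piece γ
  real_weights : ∀ Δ : ℂ, K.H.HasEigenvalue Δ → Δ.im = 0

namespace TwistGrading

variable {A : VertexAlgebra V} {K : Hamiltonian A} {Γ : AddSubgroup ℝ} (G : TwistGrading K Γ)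

/-- The vectors of degree `γ ∈ Γ/ℤ` and conformal weight `Δ`. -/
def comp (γ : ModZ Γ) (Δ : ℝ) : Submodule ℂ V := G.piece γ ⊓ K.H.eigenspace (Δ : ℂ)

open scoped Classical in
/-- `a_(n,ħ,Γ) b` for `a, b ∈ V`: the coefficient of `z^{-n-1}` in `(1 + ħ z)^{γ_a} Y(a,z) b`,
where `γ_a = Δ_a + ε_a`. -/
def prodV (n : ℤ) : V →ₗ[ℂ] V →ₗ[ℂ] Hb V :=
  extend G.piece G.internal fun γ =>
    extend (fun Δ : ℂ => K.H.eigenspace Δ) K.diagonalizable fun Δ =>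
      A.powProd (Δ + (eps γ Δ.re : ℂ)) n

theorem prodV_of_mem (n : ℤ) {γ : ModZ Γ} {Δ : ℝ} {a : V} (ha : a ∈ G.comp γ Δ) :
    G.prodV n a = A.powProd ((Δ + eps γ Δ : ℝ) : ℂ) n a := by
  classical
  unfold prodV
  rw [extend_of_mem _ _ _ ha.1, extend_of_mem _ _ _ ha.2]
  simp

theorem prodV_eventually_zero (a b : V) :
    ∃ N : ℕ, ∀ j : ℕ, N ≤ j → G.prodV j a b = 0 := by
  classical
  exact extend_eventually_zero _ G.internal
    (fun n γ => extend (fun Δ : ℂ => K.H.eigenspace Δ) K.diagonalizable fun Δ =>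
      A.powProd (Δ + (eps γ Δ.re : ℂ)) n)
    (fun γ a b => extend_eventually_zero _ K.diagonalizable
      (fun n Δ => A.powProd (Δ + (eps γ Δ.re : ℂ)) n)
      (fun Δ a b => (A.seriesProd_eventually_zero a b).imp fun _ hN => hN _) a b) a b

/-- The `(n,ħ,Γ)`-product on `V[ħ]`. -/
def prod (n : ℤ) : Hb V →ₗ[ℂ[X]] Hb V →ₗ[ℂ[X]] Hb V := bilinExt (G.prodV n)

/-- The bracket `[a,b]_{ħ,Γ} = ∑ j, (-ħ)^j a_(j,ħ,Γ) b` on `V[ħ]`. -/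
def bracket : Hb V →ₗ[ℂ[X]] Hb V →ₗ[ℂ[X]] Hb V :=
  bilinExt (bracketOf G.prodV G.prodV_eventually_zero)

/-- `V_{ħ,Γ}`: the `ℂ[ħ]`-span of the homogeneous `a ∈ V` with `ε_a = 0`. -/
def VG : Submodule ℂ[X] (Hb V) :=
  Submodule.span ℂ[X] {x | ∃ (γ : ModZ Γ) (Δ : ℝ), eps γ Δ = 0 ∧ ∃ a ∈ G.comp γ Δ, x = incl a}

/-- `J_{ħ,Γ}`: the `ℂ[ħ]`-span of the elements `a_(-2+χ(a,b),ħ,Γ) b`, for homogeneous `a, b ∈ V`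
with `ε_a + ε_b ∈ ℤ`. -/
def J : Submodule ℂ[X] (Hb V) :=
  Submodule.span ℂ[X] {x | ∃ (γ₁ γ₂ : ModZ Γ) (Δ₁ Δ₂ : ℝ),
    (∃ k : ℤ, eps γ₁ Δ₁ + eps γ₂ Δ₂ = k) ∧
    ∃ a ∈ G.comp γ₁ Δ₁, ∃ b ∈ G.comp γ₂ Δ₂,
      x = G.prod (-2 + chi (eps γ₁ Δ₁) (eps γ₂ Δ₂)) (incl a) (incl b)}

/-- The quotient `V_{ħ,Γ} / J_{ħ,Γ}` (this is meaningful when `J_{ħ,Γ} ⊆ V_{ħ,Γ}`). -/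
abbrev Zhu : Type u := G.VG ⧸ G.J.submoduleOf G.VG

end TwistGrading

end VertexAlgebra

/-! ### Superalgebras -/

/-- The `ℂ[ħ]`-module `Q`, with the product `mul`, the element `one` and the even and odd parts
`par 0`, `par 1`, is a unital associative superalgebra over `ℂ[ħ]`: these data are carried by a
`ℂ[ħ]`-linear isomorphism to those of an (associative, unital) `ℤ/2`-graded algebra. -/
def IsSuperalgebra {Q : Type u} [AddCommGroup Q] [Module ℂ[X] Q] (mul : Q → Q → Q) (one : Q)
    (par : ZMod 2 → Submodule ℂ[X] Q) : Prop :=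
  ∃ (B : Type u) (_ : Ring B) (_ : Algebra ℂ[X] B) (e : Q ≃ₗ[ℂ[X]] B),
    (∀ x y, e (mul x y) = e x * e y) ∧ e one = 1 ∧
    Nonempty (GradedAlgebra fun α => (par α).map e.toLinearMap)

end

end ZhuAlg

open ZhuAlg

namespace ZhuAlg

open Finset.HasAntidiagonal (antidiagonal)

/-! ### Binomial identities behind the change of variable from `z` to `w`. -/

section Binomial

/-! Put `Y_g(a,z) = (1 + ħz)^g Y(a,z)`, with modes `powProd g n a`. Writing `1 + ħz = (1 + ħw) + ħ(z
- w)` shows that `Y_g(a,z)` and `Y_h(b,w)` again satisfy a Borcherds identity (`powProd_borcherds`).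
The fields of `a_(n)b` are replaced there by `iterProd`: the sum over `r` of `binom(g,r) ħ^r` times
the fields of `a_(n+r)b` with exponent `g + h - r`. For `g = γ_a` and `h = γ_b` this exponent
exceeds the proper exponent of `a_(n+r)b` by the integer `n + 1 - χ(a,b)`, whatever `r` is
(`wt_deg_sub`). By Pascal's rule a surplus of `e ≥ 0` factors `1 + ħw` only raises the mode by
amounts between `0` and `e`. All the claims thus become a count of modes.

Translation covariance puts every mode up to `-2 + χ` in `J` (`P_mem_J`). The commutator formula
then makes `J` a left ideal; the formula for iterated products makes it a right ideal and gives
associativity modulo `J`. The commutator formula applied to the vacuum gives skew-symmetry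
(`skew_mem_J`), where `χ` decides whether the surplus reaches the mode `-1`, the only one that
leaves something outside `J`. Hence `ħ[x,v]` is a supercommutator modulo `J`, so the bracket
statement follows from the ideal property.

The argument is run once, over `HomogData`, which retains only how `γ` and `ε` behave under
`a_(n)b`. The eigenspaces of `H` with `ε = 0` give the `ħ`-deformation, and the components of given
degree and weight give the `(ħ,Γ)`-deformation. -/

/-- Vandermonde's identity, padded to a range that depends on neither `s` nor `J`, so that the sum
can be exchanged with an outer sum over `s`; the added terms vanish. -/
theorem choose_add_nat_right (x : ℂ) {s N : ℕ} (hs : s ≤ N) (J : ℕ) :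
    Ring.choose (x + s) J = ∑ r ∈ Finset.range (N + 1),
      (if r ≤ J then Ring.choose x (J - r) else 0) * (Nat.choose s r : ℂ) := by
  rw [add_comm, Ring.add_choose_eq J (Commute.all _ _), Finset.Nat.sum_antidiagonal_eq_sum_range_succ
    (fun i j => Ring.choose (s : ℂ) i * Ring.choose x j)]
  simp only [Ring.choose_natCast]
  have h1 : ∀ M, J ≤ M → s ≤ M → ∑ k ∈ Finset.range (J + 1), (Nat.choose s k : ℂ) *
      Ring.choose x (J - k) = ∑ r ∈ Finset.range (M + 1),
      (if r ≤ J then Ring.choose x (J - r) else 0) * (Nat.choose s r : ℂ) := by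
    intro M hJ _
    rw [← Finset.sum_subset (Finset.range_subset_range.2 (Nat.succ_le_succ hJ))]
    · refine Finset.sum_congr rfl fun r hr => ?_
      rw [if_pos (Nat.lt_succ_iff.1 (Finset.mem_range.1 hr)), mul_comm]
    · intro r _ hr
      rw [if_neg (by simpa [Nat.lt_succ_iff] using hr), zero_mul]
  rw [h1 (max J N) (le_max_left _ _) (hs.trans (le_max_right _ _))]
  symm
  refine Finset.sum_subset (Finset.range_subset_range.2
    (Nat.succ_le_succ (le_max_right _ _))) fun r _ hr => ?_
  rw [Nat.choose_eq_zero_of_lt (by simp at hr; omega), Nat.cast_zero, mul_zero]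

/-- Trinomial revision turns `binom(g,i) binom(i,r)` into `binom(g,r) binom(g-r,i-r)`; Vandermonde
sums the rest. -/
theorem sum_choose_mul_choose_mul_choose (g h : ℂ) {r N : ℕ} (hr : r ≤ N) :
    ∑ p ∈ antidiagonal N, Ring.choose g p.1 * (Nat.choose p.1 r : ℂ) * Ring.choose h p.2
      = Ring.choose g r * Ring.choose (g + h - r) (N - r) := by
  obtain ⟨M, rfl⟩ := Nat.exists_eq_add_of_le hr
  rw [Finset.Nat.sum_antidiagonal_eq_sum_range_succ
    (fun i j => Ring.choose g i * (Nat.choose i r : ℂ) * Ring.choose h j), Nat.succ_eq_add_one,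
    add_assoc,
    Finset.sum_range_add, Finset.sum_eq_zero, zero_add, Nat.add_sub_cancel_left,
    show g + h - r = (g - r) + h by ring, Ring.add_choose_eq M (Commute.all _ _),
    Finset.Nat.sum_antidiagonal_eq_sum_range_succ
      (fun i j => Ring.choose (g - r) i * Ring.choose h j), Finset.mul_sum]
  · refine Finset.sum_congr rfl fun i _ => ?_
    have := Ring.choose_smul_choose g (Nat.le_add_right r i)
    rw [nsmul_eq_mul, Nat.add_sub_cancel_left] at this
    rw [mul_comm (Ring.choose g (r + i)), this, Nat.add_sub_add_left, mul_assoc]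
  · intro i hi
    rw [Nat.choose_eq_zero_of_lt (Finset.mem_range.1 hi)]
    simp

/-- The coefficient form of `(1 + ħz)^g = ∑ r, binom(g,r) ħ^r (z - w)^r (1 + ħw)^(g-r)`. It is the
only combinatorial input to the deformed Borcherds identity. -/
theorem sum_choose_mul_choose_add (g h x : ℂ) (N J : ℕ) :
    ∑ p ∈ antidiagonal N, Ring.choose g p.1 * Ring.choose h p.2 * Ring.choose (x + p.1) J
      = ∑ p ∈ antidiagonal N, Ring.choose g p.1 * Ring.choose (g + h - p.1) p.2 *
          (if p.1 ≤ J then Ring.choose x (J - p.1) else 0) := by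
  have h1 : ∀ p ∈ antidiagonal N,
      Ring.choose g p.1 * Ring.choose h p.2 * Ring.choose (x + p.1) J
      = ∑ r ∈ Finset.range (N + 1), (if r ≤ J then Ring.choose x (J - r) else 0) *
        (Ring.choose g p.1 * (Nat.choose p.1 r : ℂ) * Ring.choose h p.2) := by
    intro p hp
    rw [choose_add_nat_right x (Finset.HasAntidiagonal.antidiagonal.fst_le hp), Finset.mul_sum]
    exact Finset.sum_congr rfl fun r _ => by ring
  rw [Finset.sum_congr rfl h1, Finset.sum_comm, Finset.Nat.sum_antidiagonal_eq_sum_range_succ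
    (fun i j => Ring.choose g i * Ring.choose (g + h - i) j *
          (if i ≤ J then Ring.choose x (J - i) else 0))]
  refine Finset.sum_congr rfl fun r hr => ?_
  rw [← Finset.mul_sum, sum_choose_mul_choose_mul_choose g h
    (Nat.lt_succ_iff.1 (Finset.mem_range.1 hr)), mul_comm]

theorem choose_neg_one (i : ℕ) : Ring.choose (-1 : ℂ) i = (-1) ^ i := by
  induction i with
  | zero => simp
  | succ i ih =>
    have := Ring.choose_succ_succ (-1 : ℂ) i
    rw [neg_add_cancel, Ring.choose_zero_succ, ih] at this
    rw [pow_succ]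
    linear_combination -this

theorem choose_neg_two (j : ℕ) : Ring.choose (-2 : ℂ) j = (-1) ^ j * (j + 1) := by
  induction j with
  | zero => simp
  | succ j ih =>
    have := Ring.choose_succ_succ (-2 : ℂ) j
    rw [show (-2 : ℂ) + 1 = -1 by norm_num, choose_neg_one, ih] at this
    push_cast
    rw [pow_succ] at this ⊢
    linear_combination -this

end Binomial

section Finsum

theorem finsum_eq_sum_range {M : Type*} [AddCommMonoid M] {f : ℕ → M} {L : ℕ}
    (h : ∀ j, L ≤ j → f j = 0) : ∑ᶠ j, f j = ∑ j ∈ Finset.range L, f j :=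
  finsum_eq_sum_of_support_subset f fun j hj => by
    by_contra hlt
    exact hj (h j (by simpa using hlt))

theorem finite_support_of_eventually_zero {M : Type*} [Zero M] {f : ℕ → M} {L : ℕ}
    (h : ∀ j, L ≤ j → f j = 0) : (Function.support f).Finite :=
  (Set.finite_lt_nat L).subset fun j hj => by
    by_contra hlt
    exact hj (h j (not_lt.1 hlt))

theorem finsum_mem_submodule {M R : Type*} [AddCommGroup M] [Ring R] [Module R M]
    (J : Submodule R M) {f : ℕ → M} (h : ∀ j, f j ∈ J) : ∑ᶠ j, f j ∈ J :=
  finsum_induction (· ∈ J) J.zero_mem (fun _ _ => J.add_mem) h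

end Finsum

/-! ### Comparison of coefficients of powers of `ħ`. -/

section Coefficients

variable {V : Type u} [AddCommGroup V] [Module ℂ V]

/-- The coefficient of `ħ^N` of an element of `V[ħ]`. -/
noncomputable def hbCoeff (N : ℕ) : Hb V →ₗ[ℂ] V :=
  (TensorProduct.lid ℂ V).toLinearMap ∘ₗ (Polynomial.lcoeff ℂ N).rTensor V

@[simp]
theorem hbCoeff_tmul (N : ℕ) (p : ℂ[X]) (v : V) : hbCoeff N (p ⊗ₜ[ℂ] v) = p.coeff N • v := by
  simp [hbCoeff]

theorem Hb.induction {P : Hb V → Prop} (zero : P 0) (add : ∀ x y, P x → P y → P (x + y))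
    (tmul : ∀ (p : ℂ[X]) (v : V), P (p ⊗ₜ[ℂ] v)) (x : Hb V) : P x :=
  TensorProduct.induction_on x zero tmul add

theorem hbCoeff_ext {x y : Hb V} (h : ∀ N, hbCoeff N x = hbCoeff N y) : x = y := by
  apply (TensorProduct.equivFinsuppOfBasisLeft (N := V) (Polynomial.basisMonomials ℂ)).injective
  ext N
  rw [TensorProduct.equivFinsuppOfBasisLeft_apply, TensorProduct.equivFinsuppOfBasisLeft_apply]
  have : (Polynomial.basisMonomials ℂ).coord N = Polynomial.lcoeff ℂ N := by
    ext; simp [Polynomial.basisMonomials, Polynomial.coeff_monomial, Finsupp.single_apply]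
  rw [this]
  exact h N

theorem hbCoeff_X_pow_smul (N j : ℕ) (x : Hb V) :
    hbCoeff N ((Polynomial.X ^ j : ℂ[X]) • x) = if j ≤ N then hbCoeff (N - j) x else 0 := by
  induction x using Hb.induction with
  | zero => simp
  | add x y hx hy => rw [smul_add, map_add, hx, hy]; split_ifs <;> simp
  | tmul p v =>
    rw [TensorProduct.smul_tmul', hbCoeff_tmul, smul_eq_mul, Polynomial.coeff_X_pow_mul']
    split_ifs <;> simp

/-- A Cauchy product: by linearity `y` may be taken to be a monomial in `ħ` times a vector, which
only shifts degrees. -/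
theorem hbCoeff_liftBaseChange (φ : V →ₗ[ℂ] Hb V) (N : ℕ) (y : Hb V) :
    hbCoeff N (φ.liftBaseChange ℂ[X] y)
      = ∑ p ∈ antidiagonal N, hbCoeff p.1 (φ (hbCoeff p.2 y)) := by
  induction y using Hb.induction with
  | zero => simp
  | add x y hx hy => simp only [map_add, hx, hy, Finset.sum_add_distrib]
  | tmul p v =>
    rw [LinearMap.liftBaseChange_tmul]
    induction p using Polynomial.induction_on' with
    | add p q hp hq => simp only [add_smul, TensorProduct.add_tmul, map_add, hp, hq,
        Finset.sum_add_distrib]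
    | monomial t c =>
      have hc : (Polynomial.monomial t c : ℂ[X]) • φ v
          = c • ((Polynomial.X ^ t : ℂ[X]) • φ v) := by
        rw [← smul_assoc, Polynomial.smul_X_eq_monomial]
      rw [hc, map_smul, hbCoeff_X_pow_smul]
      simp only [hbCoeff_tmul, Polynomial.coeff_monomial, map_smul]
      split_ifs with ht
      · rw [Finset.sum_eq_single_of_mem (N - t, t) (by simp [ht])]
        · simp
        · intro p hp hne
          rw [if_neg, zero_smul]
          rintro rfl
          rw [Finset.HasAntidiagonal.mem_antidiagonal] at hp
          exact hne (Prod.ext (by simp; omega) rfl)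
      · rw [Finset.sum_eq_zero, smul_zero]
        intro p hp
        rw [Finset.HasAntidiagonal.mem_antidiagonal] at hp
        rw [if_neg (by omega), zero_smul]

end Coefficients

/-! ### Deformed fields and their Borcherds identity. -/

namespace VertexAlgebra

variable {V : Type u} [AddCommGroup V] [Module ℂ V] (A : VertexAlgebra V)

theorem nth_finite (n : ℤ) (a b : V) : ∃ L : ℕ, ∀ j : ℕ, L ≤ j → A.nth (n + j) a b = 0 := by
  obtain ⟨N, hN⟩ := (nthProduct_finite A.Y n a b).bddAbove
  refine ⟨N + 1, fun j hj => ?_⟩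
  by_contra hne
  have := hN hne
  omega

theorem seriesProd_finite (c : ℕ → ℂ) (n : ℤ) (a b : V) : ∃ L : ℕ, ∀ j : ℕ, L ≤ j →
    c j • ((Polynomial.X ^ j : ℂ[X]) ⊗ₜ[ℂ] A.nth (n + j) a b) = 0 :=
  (A.nth_finite n a b).imp fun L hL j hj => by simp [hL j hj]

theorem powProd_apply (g : ℂ) (n : ℤ) (a b : V) :
    A.powProd g n a b
      = ∑ᶠ j : ℕ, Ring.choose g j • (Polynomial.X ^ j : ℂ[X]) • incl (A.nth (n + j) a b) := by
  simp [powProd, seriesProd_apply, incl, TensorProduct.smul_tmul']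

/-- Each power of `ħ` carries a single ordinary mode, so identities between deformed products can be
checked on ordinary modes. -/
theorem hbCoeff_powProd (g : ℂ) (n : ℤ) (a b : V) (N : ℕ) :
    hbCoeff N (A.powProd g n a b) = Ring.choose g N • A.nth (n + N) a b := by
  obtain ⟨L, hL⟩ := A.seriesProd_finite (fun j => Ring.choose g j) n a b
  rw [powProd, seriesProd_apply, map_finsum _ (finite_support_of_eventually_zero hL),
    finsum_eq_single _ N]
  · simp
  · intro j hj
    simp [Polynomial.coeff_X_pow, hj.symm]

theorem powProd_eventually_zero (n : ℤ) (a b : V) :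
    ∃ L : ℕ, ∀ (g : ℂ) (j : ℕ), L ≤ j → A.powProd g (n + j) a b = 0 := by
  obtain ⟨L, hL⟩ := A.nth_finite n a b
  refine ⟨L, fun g j hj => hbCoeff_ext fun N => ?_⟩
  rw [hbCoeff_powProd, add_assoc, ← Nat.cast_add, hL (j + N) (by omega)]
  simp

/-- Pascal's rule: `(1 + ħz)^{g+1} Y(a,z) = (1 + ħz) (1 + ħz)^g Y(a,z)`. -/
theorem powProd_add_one (g : ℂ) (n : ℤ) (a b : V) :
    A.powProd (g + 1) n a b
      = A.powProd g n a b + (Polynomial.X : ℂ[X]) • A.powProd g (n + 1) a b := by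
  refine hbCoeff_ext fun N => ?_
  rw [map_add, ← pow_one (Polynomial.X : ℂ[X]), hbCoeff_X_pow_smul, hbCoeff_powProd,
    hbCoeff_powProd, hbCoeff_powProd]
  rcases N with _ | N
  · simp
  · rw [if_pos (by omega), Ring.choose_succ_succ, add_smul, add_comm, Nat.add_sub_cancel,
      show n + 1 + (N : ℤ) = n + ((N + 1 : ℕ) : ℤ) by push_cast; ring]

theorem powProd_zero (n : ℤ) (a b : V) : A.powProd 0 n a b = incl (A.nth n a b) := by
  refine hbCoeff_ext fun N => ?_
  rw [hbCoeff_powProd, Ring.choose_zero_ite]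
  rcases N with _ | N <;> simp [incl, Polynomial.coeff_one]

theorem nth_vac_left (n : ℤ) (a : V) : A.nth n A.vac a = if n = -1 then a else 0 :=
  A.vac_left n a

theorem nth_vac_right (n : ℤ) (hn : -1 ≤ n) (a : V) :
    A.nth n a A.vac = if n = -1 then a else 0 := A.vac_right n a hn

theorem powProd_neg_one_vac (g : ℂ) (a : V) : A.powProd g (-1) a A.vac = incl a := by
  refine hbCoeff_ext fun N => ?_
  rw [hbCoeff_powProd, nth_vac_right _ _ (by omega)]
  rcases N with _ | N
  · simp [incl]
  · rw [if_neg (by omega)]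
    simp [incl, Polynomial.coeff_one]

theorem powProd_neg_two_vac (g : ℂ) (a : V) :
    A.powProd g (-2) a A.vac = incl (A.T a) + (Polynomial.X : ℂ[X]) • g • incl a := by
  refine hbCoeff_ext fun N => ?_
  rw [hbCoeff_powProd, map_add, ← pow_one (Polynomial.X : ℂ[X]), hbCoeff_X_pow_smul]
  rcases N with _ | _ | N
  · simp [incl, T]
  · rw [nth_vac_right _ _ (by omega)]
    simp [incl, Polynomial.coeff_one]
  · rw [nth_vac_right _ _ (by omega), if_neg (by omega)]
    simp [incl, Polynomial.coeff_one]

theorem borcherds' (m n k : ℤ) {α β : ZMod 2} {a b : V} (c : V) (ha : a ∈ A.parity α)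
    (hb : b ∈ A.parity β) :
    ∑ᶠ j : ℕ, ((-1 : ℂ) ^ j * (Ring.choose (n : ℂ) j)) •
      (A.nth (m + n - j) a (A.nth (k + j) b c)
        - ((-1 : ℂ) ^ n * sgn α β) • A.nth (n + k - j) b (A.nth (m + j) a c))
    = ∑ᶠ j : ℕ, (Ring.choose (m : ℂ) j) • A.nth (m + k - j) (A.nth (n + j) a b) c :=
  A.borcherds m n k c ha hb

/-- The expansion of `Res_{z-w} (z - w)^p (1 + ħz)^g (1 + ħw)^h Y(a,z) Y(b,w) c`, the coefficient
of `w^{-q-1}`. -/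
noncomputable def iterProd (g h : ℂ) (p q : ℤ) (a b c : V) : Hb V :=
  ∑ᶠ r : ℕ, Ring.choose g r • (Polynomial.X ^ r : ℂ[X]) •
    A.powProd (g + h - r) q (A.nth (p + r) a b) c

theorem hbCoeff_iterProd (g h : ℂ) (p q : ℤ) (a b c : V) (N : ℕ) :
    hbCoeff N (A.iterProd g h p q a b c) = ∑ x ∈ antidiagonal N,
      (Ring.choose g x.1 * Ring.choose (g + h - x.1) x.2) •
        A.nth (q + x.2) (A.nth (p + x.1) a b) c := by
  obtain ⟨L, hL⟩ := A.nth_finite p a b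
  have h0 : ∀ r, L + N + 1 ≤ r → Ring.choose g r • (Polynomial.X ^ r : ℂ[X]) •
      A.powProd (g + h - r) q (A.nth (p + r) a b) c = 0 := fun r hr => by
    rw [hL r (by omega)]; simp
  rw [iterProd, finsum_eq_sum_range h0, map_sum, Finset.Nat.sum_antidiagonal_eq_sum_range_succ
    (fun i j => (Ring.choose g i * Ring.choose (g + h - i) j) •
        A.nth (q + j) (A.nth (p + i) a b) c)]
  symm
  rw [← Finset.sum_subset (Finset.range_subset_range.2 (show N + 1 ≤ L + N + 1 by omega))]
  · refine Finset.sum_congr rfl fun r hr => ?_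
    rw [map_smul, hbCoeff_X_pow_smul, if_pos (by simp at hr; omega), hbCoeff_powProd, mul_smul]
  · intro r _ hr
    rw [map_smul, hbCoeff_X_pow_smul, if_neg (by simp at hr; omega), smul_zero]

theorem iterProd_eventually_zero (g h : ℂ) (p : ℤ) (a b c : V) :
    ∃ L : ℕ, ∀ (q : ℤ) (j : ℕ), L ≤ j → A.iterProd g h (p + j) q a b c = 0 := by
  obtain ⟨L, hL⟩ := A.nth_finite p a b
  refine ⟨L, fun q j hj => finsum_eq_zero_of_forall_eq_zero fun r => ?_⟩
  rw [add_assoc, ← Nat.cast_add, hL _ (by omega)]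
  simp

theorem hbCoeff_lift_powProd (g h : ℂ) (p q : ℤ) (a b c : V) (N : ℕ) :
    hbCoeff N ((A.powProd g p a).liftBaseChange ℂ[X] (A.powProd h q b c))
      = ∑ x ∈ antidiagonal N, (Ring.choose g x.1 * Ring.choose h x.2) •
        A.nth (p + x.1) a (A.nth (q + x.2) b c) := by
  rw [hbCoeff_liftBaseChange]
  refine Finset.sum_congr rfl fun x _ => ?_
  rw [hbCoeff_powProd, hbCoeff_powProd, map_smul, smul_smul]

/-- Borcherds' identity for the fields `(1 + ħz)^g Y(a,z)` and `(1 + ħw)^h Y(b,w)`. -/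
theorem powProd_borcherds (g h : ℂ) (m n k : ℤ) {α β : ZMod 2} {a b : V} (c : V)
    (ha : a ∈ A.parity α) (hb : b ∈ A.parity β) :
    ∑ᶠ j : ℕ, ((-1 : ℂ) ^ j * (Ring.choose (n : ℂ) j)) •
      ((A.powProd g (m + n - j) a).liftBaseChange ℂ[X] (A.powProd h (k + j) b c)
        - ((-1 : ℂ) ^ n * sgn α β) •
          (A.powProd h (n + k - j) b).liftBaseChange ℂ[X] (A.powProd g (m + j) a c))
    = ∑ᶠ j : ℕ, (Ring.choose (m : ℂ) j) • A.iterProd g h (n + j) (m + k - j) a b c := by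
  obtain ⟨L₁, h₁⟩ := A.nth_finite k b c
  obtain ⟨L₂, h₂⟩ := A.nth_finite m a c
  obtain ⟨L, hL⟩ := A.nth_finite n a b
  obtain ⟨L₃, h₃⟩ := A.powProd_eventually_zero k b c
  obtain ⟨L₄, h₄⟩ := A.powProd_eventually_zero m a c
  obtain ⟨L₅, h₅⟩ := A.iterProd_eventually_zero g h n a b c
  refine hbCoeff_ext fun N => ?_
  rw [map_finsum _ (finite_support_of_eventually_zero (L := max L₃ L₄) fun j hj => by
      rw [h₃ _ j (by omega), h₄ _ j (by omega)]; simp),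
    map_finsum _ (finite_support_of_eventually_zero (L := L₅) fun j hj => by
      rw [h₅ _ j (by omega)]; simp)]
  -- For each splitting `N = x.1 + x.2` the summands are those of the undeformed Borcherds identity
  -- with `m` and `k` raised by `x.1` and `x.2`.
  have lhs : ∀ j : ℕ, hbCoeff N (((-1 : ℂ) ^ j * (Ring.choose (n : ℂ) j)) •
      ((A.powProd g (m + n - j) a).liftBaseChange ℂ[X] (A.powProd h (k + j) b c)
        - ((-1 : ℂ) ^ n * sgn α β) •
          (A.powProd h (n + k - j) b).liftBaseChange ℂ[X] (A.powProd g (m + j) a c)))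
      = ∑ x ∈ antidiagonal N, (Ring.choose g x.1 * Ring.choose h x.2) •
        ((-1 : ℂ) ^ j * (Ring.choose (n : ℂ) j)) •
        (A.nth ((m + x.1) + n - j) a (A.nth ((k + x.2) + j) b c)
        - ((-1 : ℂ) ^ n * sgn α β) • A.nth (n + (k + x.2) - j) b (A.nth ((m + x.1) + j) a c)) := by
    intro j
    rw [map_smul, map_sub, map_smul, hbCoeff_lift_powProd, hbCoeff_lift_powProd,
      ← Finset.Nat.sum_antidiagonal_swap (f := fun x => (Ring.choose h x.1 * Ring.choose g x.2) •
        A.nth (n + k - j + x.1) b (A.nth (m + j + x.2) a c)), Finset.smul_sum,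
      ← Finset.sum_sub_distrib, Finset.smul_sum]
    refine Finset.sum_congr rfl fun x _ => ?_
    rw [smul_comm (Ring.choose g x.1 * Ring.choose h x.2), smul_sub (Ring.choose g x.1 * _),
      smul_comm (Ring.choose g x.1 * Ring.choose h x.2) ((-1 : ℂ) ^ n * _)]
    simp only [Prod.fst_swap, Prod.snd_swap]
    rw [mul_comm (Ring.choose h x.2)]
    rw [show m + n - j + x.1 = m + x.1 + n - j by ring, show k + j + (x.2 : ℤ) = k + x.2 + j by ring,
      show n + k - j + (x.2 : ℤ) = n + (k + x.2) - j by ring,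
      show m + j + (x.1 : ℤ) = m + x.1 + j by ring]
  rw [finsum_congr lhs, finsum_sum_comm]
  swap
  · intro x _
    refine finite_support_of_eventually_zero (L := max L₁ L₂) fun j hj => ?_
    rw [add_assoc k, add_assoc m _ (j : ℤ), ← Nat.cast_add, ← Nat.cast_add, h₁ _ (by omega),
      h₂ _ (by omega)]
    simp
  -- Both sides are combinations of these vectors, so it remains to compare the scalar coefficients
  -- of each `f J`.
  set f : ℕ → V := fun J => A.nth (m + k + N - J) (A.nth (n + J) a b) c with hf
  have hfL : ∀ J, L ≤ J → f J = 0 := fun J hJ => by simp [hf, hL J hJ]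
  have lhs' : ∀ x ∈ antidiagonal N, ∑ᶠ j : ℕ, (Ring.choose g x.1 * Ring.choose h x.2) •
        ((-1 : ℂ) ^ j * (Ring.choose (n : ℂ) j)) •
        (A.nth ((m + x.1) + n - j) a (A.nth ((k + x.2) + j) b c)
        - ((-1 : ℂ) ^ n * sgn α β) • A.nth (n + (k + x.2) - j) b (A.nth ((m + x.1) + j) a c))
      = ∑ J ∈ Finset.range L, (Ring.choose g x.1 * Ring.choose h x.2 *
          Ring.choose ((m : ℂ) + x.1) J) • f J := by
    intro x hx
    rw [← smul_finsum, A.borcherds' _ n _ c ha hb, finsum_eq_sum_range (L := L) fun j hj => by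
      rw [hL j hj]; simp, Finset.smul_sum]
    refine Finset.sum_congr rfl fun J _ => ?_
    rw [Finset.HasAntidiagonal.mem_antidiagonal] at hx
    simp only [hf, ← hx]
    rw [show m + x.1 + (k + x.2) - (J : ℤ) = m + k + ((x.1 + x.2 : ℕ) : ℤ) - J by push_cast; ring,
      Int.cast_add, Int.cast_natCast, mul_smul, mul_smul, mul_smul]
  have rhs : ∀ j : ℕ, hbCoeff N (Ring.choose (m : ℂ) j • A.iterProd g h (n + j) (m + k - j) a b c)
      = ∑ x ∈ antidiagonal N, Ring.choose (m : ℂ) j •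
        (Ring.choose g x.1 * Ring.choose (g + h - x.1) x.2) • f (j + x.1) := by
    intro j
    rw [map_smul, hbCoeff_iterProd, Finset.smul_sum]
    refine Finset.sum_congr rfl fun x hx => ?_
    rw [Finset.HasAntidiagonal.mem_antidiagonal] at hx
    simp only [hf, ← hx]
    rw [show m + k - (j : ℤ) + x.2 = m + k + ((x.1 + x.2 : ℕ) : ℤ) - ((j + x.1 : ℕ) : ℤ) by
      push_cast; ring, Nat.cast_add j, add_assoc n]
  rw [Finset.sum_congr rfl lhs', finsum_congr rhs, finsum_sum_comm]
  swap
  · exact fun x _ => finite_support_of_eventually_zero (L := L) fun j hj => by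
      rw [hfL _ (by omega)]; simp
  have rhs' : ∀ x ∈ antidiagonal N, ∑ᶠ j : ℕ, Ring.choose (m : ℂ) j •
        (Ring.choose g x.1 * Ring.choose (g + h - x.1) x.2) • f (j + x.1)
      = ∑ J ∈ Finset.range L, (Ring.choose g x.1 * Ring.choose (g + h - x.1) x.2 *
          (if x.1 ≤ J then Ring.choose (m : ℂ) (J - x.1) else 0)) • f J := by
    intro x _
    rw [finsum_eq_sum_range (L := L) fun j hj => by rw [hfL _ (by omega)]; simp]
    have h0 : ∀ J, L ≤ J → (Ring.choose g x.1 * Ring.choose (g + h - x.1) x.2 *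
          (if x.1 ≤ J then Ring.choose (m : ℂ) (J - x.1) else 0)) • f J = 0 := fun J hJ => by
      rw [hfL J hJ, smul_zero]
    -- Reindexing by `J = j + x.1`: the range is lengthened by `x.1`, and its first `x.1` terms have
    -- coefficient zero.
    rw [← finsum_eq_sum_range h0, finsum_eq_sum_range (L := x.1 + L) fun J hJ => h0 J (by omega),
      Finset.sum_range_add, Finset.sum_eq_zero (s := Finset.range x.1), zero_add]
    · refine Finset.sum_congr rfl fun j _ => ?_
      rw [if_pos (Nat.le_add_right _ _), Nat.add_sub_cancel_left, smul_smul, add_comm j,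
        mul_comm]
    · intro J hJ
      rw [if_neg (by simpa using hJ), mul_zero, zero_smul]
  rw [Finset.sum_congr rfl rhs', Finset.sum_comm, Finset.sum_comm (s := antidiagonal N)]
  refine Finset.sum_congr rfl fun J _ => ?_
  rw [← Finset.sum_smul, ← Finset.sum_smul, sum_choose_mul_choose_add]

theorem parity_induction {P : V → Prop} (add : ∀ x y, P x → P y → P (x + y)) (zero : P 0)
    (mem : ∀ (α : ZMod 2) (x : V), x ∈ A.parity α → P x) (x : V) : P x :=
  Submodule.iSup_induction A.parity (motive := P)
    (show x ∈ ⨆ α, A.parity α from A.parity_internal.submodule_iSup_eq_top ▸ Submodule.mem_top)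
    mem zero add

/-- `(Ta)_(n) = -n a_(n-1)`. -/
theorem nth_T (n : ℤ) (a b : V) : A.nth n (A.T a) b = -(n : ℂ) • A.nth (n - 1) a b := by
  induction a using A.parity_induction with
  | zero => simp
  | add x y hx hy => simp only [map_add, LinearMap.add_apply, hx, hy, smul_add]
  | mem α a ha =>
    -- With the vacuum as second vector, a term survives only where the vacuum mode is `-1`: at `j =
    -- -1 - n` for `n < 0`, at `j = n - 1` for `n > 0`, and nowhere for `n = 0`.
    have h := A.borcherds' 0 (-2) n b ha A.vac_even
    have hr : ∑ᶠ j : ℕ, Ring.choose ((0 : ℤ) : ℂ) j •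
        A.nth (0 + n - j) (A.nth (-2 + j) a A.vac) b = A.nth n (A.T a) b := by
      rw [finsum_eq_single _ 0 fun j hj => by
        rw [Int.cast_zero, Ring.choose_zero_pos _ (Nat.pos_of_ne_zero hj), zero_smul]]
      simp [T]
    rw [hr] at h
    rw [← h]
    have hs : sgn α 0 = 1 := by simp [sgn]
    have hc : ∀ j : ℕ, (-1 : ℂ) ^ j * Ring.choose (((-2 : ℤ) : ℂ)) j = j + 1 := fun j => by
      push_cast
      rw [choose_neg_two, ← mul_assoc, ← mul_pow]
      simp
    simp only [nth_vac_left, hs, hc]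
    rcases lt_trichotomy n 0 with hn | rfl | hn
    · rw [finsum_eq_single _ (-1 - n).toNat]
      · have h1 : (((-1 - n).toNat : ℕ) : ℤ) = -1 - n := by omega
        have h2 : (((-1 - n).toNat : ℕ) : ℂ) = -1 - n := by exact_mod_cast congrArg (Int.cast : ℤ → ℂ) h1
        rw [h1, if_pos (by omega), if_neg (by omega), h2]
        simp only [smul_zero, sub_zero]
        rw [show 0 + -2 - (-1 - n) = n - 1 by ring, show -1 - (n : ℂ) + 1 = -n by ring]
      · intro j hj
        rw [if_neg (by omega), if_neg (by omega)]
        simp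
    · rw [finsum_eq_zero_of_forall_eq_zero]
      · simp
      · intro j
        rw [if_neg (by omega), if_neg (by omega)]
        simp
    · rw [finsum_eq_single _ (n - 1).toNat]
      · have h1 : (((n - 1).toNat : ℕ) : ℤ) = n - 1 := by omega
        have h2 : (((n - 1).toNat : ℕ) : ℂ) = n - 1 := by exact_mod_cast congrArg (Int.cast : ℤ → ℂ) h1
        rw [h1, if_neg (by omega), if_pos (by omega), h2]
        have h3 : (-1 : ℂ) ^ (-2 : ℤ) = 1 := by norm_num
        rw [h3]
        simp
      · intro j hj
        rw [if_neg (by omega), if_neg (by omega)]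
        simp

/-- `(1 + ħz)^{g+1} Y(Ta,z) = (1 + ħz) ∂_z ((1 + ħz)^g Y(a,z)) - ħg (1 + ħz)^g Y(a,z)`. -/
theorem powProd_T (g : ℂ) (n : ℤ) (a b : V) :
    A.powProd (g + 1) n (A.T a) b = -(n : ℂ) • A.powProd g (n - 1) a b
      - (n + 1 + g) • (Polynomial.X : ℂ[X]) • A.powProd g n a b := by
  refine hbCoeff_ext fun N => ?_
  rw [map_sub, map_smul, map_smul, ← pow_one (Polynomial.X : ℂ[X]), hbCoeff_X_pow_smul,
    hbCoeff_powProd, hbCoeff_powProd, nth_T]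
  rcases N with _ | N
  · simp
  · have h1 := Ring.choose_smul_choose (g + 1) (show 1 ≤ N + 1 by omega)
    have h2 := Ring.choose_succ_succ g N
    simp only [Nat.choose_one_right, nsmul_eq_mul, Ring.choose_one_right, Nat.add_sub_cancel,
      Nat.cast_one, add_sub_cancel_right] at h1
    rw [if_pos (by omega), hbCoeff_powProd, Nat.add_sub_cancel, smul_smul, smul_smul, smul_smul,
      show n + ((N + 1 : ℕ) : ℤ) - 1 = n + N by push_cast; ring,
      show n - 1 + ((N + 1 : ℕ) : ℤ) = n + N by push_cast; ring, ← sub_smul]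
    congr 1
    push_cast at h1 ⊢
    -- Here `h1` is the absorption identity `(N+1) binom(g+1,N+1) = (g+1) binom(g,N)` and `h2` is
    -- Pascal's rule.
    linear_combination (-1 : ℂ) * h1 - (n : ℂ) * h2

end VertexAlgebra

end ZhuAlg

namespace ZhuAlg

noncomputable section

variable {V : Type u} [AddCommGroup V] [Module ℂ V]

theorem bilinExt_incl_left (B : V →ₗ[ℂ] V →ₗ[ℂ] Hb V) (a : V) (y : Hb V) :
    bilinExt B (incl a) y = (B a).liftBaseChange ℂ[X] y := by
  simp [bilinExt, incl]

theorem liftBaseChange_incl (φ : V →ₗ[ℂ] Hb V) (v : V) :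
    φ.liftBaseChange ℂ[X] (incl v) = φ v := by
  simp [incl]

theorem Hb.incl_induction {P : Hb V → Prop} (add : ∀ x y, P x → P y → P (x + y))
    (smul_incl : ∀ (p : ℂ[X]) (v : V), P (p • incl v)) (x : Hb V) : P x := by
  induction x using Hb.induction with
  | zero => simpa using smul_incl 0 0
  | add x y hx hy => exact add x y hx hy
  | tmul p v => simpa [incl, TensorProduct.smul_tmul'] using smul_incl p v

theorem Hb.span_incl (S : Submodule ℂ[X] (Hb V)) (h : ∀ v : V, incl v ∈ S) : S = ⊤ :=
  eq_top_iff.2 fun x _ => Hb.incl_induction (P := (· ∈ S)) (fun _ _ => S.add_mem)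
    (fun p v => S.smul_mem p (h v)) x

/-! ### Commutator and iterate formulas, and shifts of the exponent. -/

namespace VertexAlgebra

variable (A : VertexAlgebra V)

theorem powProd_mem (S : Submodule ℂ[X] (Hb V)) (g : ℂ) {n : ℤ} {a b : V}
    (h : ∀ j : ℕ, incl (A.nth (n + j) a b) ∈ S) : A.powProd g n a b ∈ S := by
  rw [powProd_apply]
  exact finsum_mem_submodule S fun j => S.smul_of_tower_mem _ (S.smul_mem _ (h j))

theorem iterProd_mem (S : Submodule ℂ[X] (Hb V)) {g h : ℂ} {p q : ℤ} {a b c : V}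
    (hS : ∀ r : ℕ, A.powProd (g + h - r) q (A.nth (p + r) a b) c ∈ S) :
    A.iterProd g h p q a b c ∈ S :=
  finsum_mem_submodule S fun j => S.smul_of_tower_mem _ (S.smul_mem _ (hS j))

/-- Each extra factor `1 + ħz` raises the mode by at most one, so a surplus of `e` costs at most `e`
in the mode. -/
theorem powProd_add_nat_mem (S : Submodule ℂ[X] (Hb V)) {g : ℂ} {N : ℤ} {a b : V}
    (h : ∀ q ≤ N, A.powProd g q a b ∈ S) (e : ℕ) :
    ∀ q : ℤ, q + e ≤ N → A.powProd (g + e) q a b ∈ S := by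
  induction e with
  | zero => intro q hq; simpa using h q (by simpa using hq)
  | succ e ih =>
    intro q hq
    push_cast at hq ⊢
    rw [← add_assoc, powProd_add_one]
    exact S.add_mem (ih _ (by omega)) (S.smul_mem _ (ih _ (by omega)))

/-- The commutator formula. -/
theorem powProd_commutator (g h : ℂ) (m k : ℤ) {α β : ZMod 2} {a b : V} (c : V)
    (ha : a ∈ A.parity α) (hb : b ∈ A.parity β) :
    (A.powProd g m a).liftBaseChange ℂ[X] (A.powProd h k b c)
      - sgn α β • (A.powProd h k b).liftBaseChange ℂ[X] (A.powProd g m a c)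
    = ∑ᶠ j : ℕ, (Ring.choose (m : ℂ) j) • A.iterProd g h j (m + k - j) a b c := by
  have := A.powProd_borcherds g h m 0 k c ha hb
  rw [finsum_eq_single _ 0 fun j hj => by
    rw [Int.cast_zero, Ring.choose_zero_pos _ (Nat.pos_of_ne_zero hj), mul_zero, zero_smul]] at this
  simpa using this

/-- The formula for iterated products. -/
theorem powProd_iterate (g h : ℂ) (n k : ℤ) {α β : ZMod 2} {a b : V} (c : V)
    (ha : a ∈ A.parity α) (hb : b ∈ A.parity β) :
    ∑ᶠ j : ℕ, ((-1 : ℂ) ^ j * (Ring.choose (n : ℂ) j)) •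
      ((A.powProd g (n - j) a).liftBaseChange ℂ[X] (A.powProd h (k + j) b c)
        - ((-1 : ℂ) ^ n * sgn α β) •
          (A.powProd h (n + k - j) b).liftBaseChange ℂ[X] (A.powProd g j a c))
    = A.iterProd g h n k a b c := by
  have := A.powProd_borcherds g h 0 n k c ha hb
  rw [finsum_eq_single (fun j : ℕ => Ring.choose ((0 : ℤ) : ℂ) j • _) 0 fun j hj => by
    rw [Int.cast_zero, Ring.choose_zero_pos _ (Nat.pos_of_ne_zero hj), zero_smul]] at this
  simpa using this

theorem powProd_iterate_eventually_zero (g h : ℂ) (n k : ℤ) (s : ℂ) (a b c : V) :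
    ∃ L : ℕ, ∀ j : ℕ, L ≤ j → ((-1 : ℂ) ^ j * (Ring.choose (n : ℂ) j)) •
      ((A.powProd g (n - j) a).liftBaseChange ℂ[X] (A.powProd h (k + j) b c)
        - s • (A.powProd h (n + k - j) b).liftBaseChange ℂ[X] (A.powProd g j a c)) = 0 := by
  obtain ⟨L₁, h₁⟩ := A.powProd_eventually_zero k b c
  obtain ⟨L₂, h₂⟩ := A.powProd_eventually_zero 0 a c
  refine ⟨max L₁ L₂, fun j hj => ?_⟩
  have := h₂ g j (by omega)
  rw [zero_add] at this
  rw [h₁ _ j (by omega), this]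
  simp

theorem iterProd_add_one (g h : ℂ) (p q : ℤ) (a b c : V) :
    A.iterProd g (h + 1) p q a b c
      = A.iterProd g h p q a b c + (Polynomial.X : ℂ[X]) • A.iterProd g h p (q + 1) a b c := by
  obtain ⟨L, hL⟩ := A.nth_finite p a b
  rw [iterProd, iterProd, iterProd,
    finsum_eq_sum_range (L := L) fun r hr => by rw [hL r hr]; simp,
    finsum_eq_sum_range (L := L) fun r hr => by rw [hL r hr]; simp,
    finsum_eq_sum_range (L := L) fun r hr => by rw [hL r hr]; simp,
    Finset.smul_sum, ← Finset.sum_add_distrib]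
  refine Finset.sum_congr rfl fun r _ => ?_
  rw [show g + (h + 1) - (r : ℂ) = g + h - r + 1 by ring, powProd_add_one, smul_add, smul_add,
    smul_comm (Polynomial.X : ℂ[X]) (Ring.choose g r), smul_comm (Polynomial.X : ℂ[X])]

end VertexAlgebra

/-- A family of subspaces `comp μ` of homogeneous vectors of a vertex algebra, with the exponents
`wt μ` (the `γ_a` for `a ∈ comp μ`) and `ε μ` (the `ε_a`), and the `ħ`-deformed products which
they define. -/
structure HomogData (A : VertexAlgebra V) (M : Type*) where
  comp : M → Submodule ℂ V
  wt : M → ℂ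
  ε : M → ℝ
  deg : ℤ → M → M → M
  vacDeg : M
  P : ℤ → V →ₗ[ℂ] V →ₗ[ℂ] Hb V
  P_eventually_zero : ∀ a b, ∃ N : ℕ, ∀ j : ℕ, N ≤ j → P j a b = 0
  P_of_mem : ∀ (n : ℤ) {μ : M} {a : V}, a ∈ comp μ → P n a = A.powProd (wt μ) n a
  comp_super : ∀ μ, A.IsSubSuperspace (comp μ)
  iSup_comp : ⨆ μ, comp μ = ⊤
  nth_mem : ∀ (n : ℤ) {μ ν : M} {a b : V}, a ∈ comp μ → b ∈ comp ν → A.nth n a b ∈ comp (deg n μ ν)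
  vac_mem : A.vac ∈ comp vacDeg
  wt_vacDeg : wt vacDeg = 0
  ε_vacDeg : ε vacDeg = 0
  ε_nonpos : ∀ μ, ε μ ≤ 0
  neg_one_lt_ε : ∀ μ, -1 < ε μ
  wt_deg : ∀ n μ ν, wt (deg n μ ν) = wt μ + wt ν + chi (ε μ) (ε ν) - n - 1
  ε_deg : ∀ n μ ν, ε (deg n μ ν) = ε μ + ε ν + chi (ε μ) (ε ν)

/-! ### The span `J` for abstract homogeneous data. -/

namespace HomogData

variable {A : VertexAlgebra V} {M : Type v} (D : HomogData A M)

/-- The condition `ε_a + ε_b ∈ ℤ`. -/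
def Balanced (μ ν : M) : Prop := ∃ k : ℤ, D.ε μ + D.ε ν = k

/-- `χ(a, b)`. -/
def χ (μ ν : M) : ℤ := chi (D.ε μ) (D.ε ν)

theorem χ_eq (μ ν : M) : D.χ μ ν = 0 ∨ D.χ μ ν = 1 := by
  unfold χ chi
  split_ifs <;> simp

theorem χ_of_left {μ : M} (h : D.ε μ = 0) (ν : M) : D.χ μ ν = 0 :=
  if_neg (by rw [h]; linarith [D.neg_one_lt_ε ν])

theorem χ_of_right (μ : M) {ν : M} (h : D.ε ν = 0) : D.χ μ ν = 0 :=
  if_neg (by rw [h]; linarith [D.neg_one_lt_ε μ])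

theorem ε_deg_of_left (n : ℤ) {μ : M} (h : D.ε μ = 0) (ν : M) : D.ε (D.deg n μ ν) = D.ε ν := by
  have := D.χ_of_left h ν
  rw [χ] at this
  rw [ε_deg, this, h]
  simp

theorem ε_deg_of_right (n : ℤ) (μ : M) {ν : M} (h : D.ε ν = 0) : D.ε (D.deg n μ ν) = D.ε μ := by
  have := D.χ_of_right μ h
  rw [χ] at this
  rw [ε_deg, this, h]
  simp

variable {D} in
-- The integer `ε_a + ε_b` lies in `(-2, 0]`, so it is `0` or `-1`, and `χ` is exactly the
-- correction back to `0`.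
theorem Balanced.ε_deg {μ ν : M} (h : D.Balanced μ ν) (n : ℤ) : D.ε (D.deg n μ ν) = 0 := by
  obtain ⟨k, hk⟩ := h
  rw [D.ε_deg, hk]
  have h1 : (k : ℝ) ≤ 0 := by rw [← hk]; linarith [D.ε_nonpos μ, D.ε_nonpos ν]
  have h2 : (-2 : ℝ) < k := by rw [← hk]; linarith [D.neg_one_lt_ε μ, D.neg_one_lt_ε ν]
  have h1' : k ≤ 0 := by exact_mod_cast h1
  have h2' : -2 < k := by exact_mod_cast h2
  rw [chi, hk]
  obtain rfl | rfl : k = 0 ∨ k = -1 := by omega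
  · norm_num
  · norm_num

theorem balanced_of_eq_zero {μ ν : M} (h₁ : D.ε μ = 0) (h₂ : D.ε ν = 0) : D.Balanced μ ν :=
  ⟨0, by simp [h₁, h₂]⟩

variable {D} in
theorem Balanced.congr {μ ν μ' ν' : M} (h : D.Balanced μ ν) (h₁ : D.ε μ' = D.ε μ)
    (h₂ : D.ε ν' = D.ε ν) : D.Balanced μ' ν' := by
  rwa [Balanced, h₁, h₂]

theorem χ_congr {μ ν μ' ν' : M} (h₁ : D.ε μ' = D.ε μ) (h₂ : D.ε ν' = D.ε ν) :
    D.χ μ' ν' = D.χ μ ν := by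
  rw [χ, h₁, h₂, χ]

/-- The deformed `n`-th product on `V[ħ]`. -/
def prod (n : ℤ) : Hb V →ₗ[ℂ[X]] Hb V →ₗ[ℂ[X]] Hb V := bilinExt (D.P n)

/-- The deformed bracket on `V[ħ]`. -/
def bracket : Hb V →ₗ[ℂ[X]] Hb V →ₗ[ℂ[X]] Hb V := bilinExt (bracketOf D.P D.P_eventually_zero)

/-- The span of the homogeneous vectors `a` with `ε_a = 0`. -/
def VG : Submodule ℂ[X] (Hb V) :=
  Submodule.span ℂ[X] {x | ∃ μ, D.ε μ = 0 ∧ ∃ a ∈ D.comp μ, x = incl a}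

/-- The span of the homogeneous vectors `a` of parity `α` with `ε_a = 0`. -/
def VGParity (α : ZMod 2) : Submodule ℂ[X] (Hb V) :=
  Submodule.span ℂ[X] {x | ∃ μ, D.ε μ = 0 ∧ ∃ a ∈ D.comp μ ⊓ A.parity α, x = incl a}

/-- The span of the products `a_(-2+χ(a,b)) b`, for homogeneous `a`, `b` with `ε_a + ε_b ∈ ℤ`. -/
def J : Submodule ℂ[X] (Hb V) :=
  Submodule.span ℂ[X] {x | ∃ μ ν, D.Balanced μ ν ∧ ∃ a ∈ D.comp μ, ∃ b ∈ D.comp ν,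
    x = D.prod (-2 + D.χ μ ν) (incl a) (incl b)}

theorem prod_incl (n : ℤ) (a b : V) : D.prod n (incl a) (incl b) = D.P n a b :=
  bilinExt_incl _ a b

theorem prod_incl_left (n : ℤ) (a : V) (y : Hb V) :
    D.prod n (incl a) y = (D.P n a).liftBaseChange ℂ[X] y := bilinExt_incl_left _ a y

theorem incl_mem_VG {μ : M} (h : D.ε μ = 0) {a : V} (ha : a ∈ D.comp μ) : incl a ∈ D.VG :=
  Submodule.subset_span ⟨μ, h, a, ha, rfl⟩

theorem incl_mem_VGParity {μ : M} (h : D.ε μ = 0) {α : ZMod 2} {a : V}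
    (ha : a ∈ D.comp μ ⊓ A.parity α) : incl a ∈ D.VGParity α :=
  Submodule.subset_span ⟨μ, h, a, ha, rfl⟩

theorem comp_le (S : Submodule ℂ V) {μ : M} (h : ∀ α, D.comp μ ⊓ A.parity α ≤ S) :
    D.comp μ ≤ S := (D.comp_super μ).trans (iSup_le h)

theorem VG_le (S : Submodule ℂ[X] (Hb V))
    (h : ∀ (μ : M) (α : ZMod 2), D.ε μ = 0 → ∀ a ∈ D.comp μ, a ∈ A.parity α → incl a ∈ S) :
    D.VG ≤ S := by
  refine Submodule.span_le.2 ?_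
  rintro _ ⟨μ, hμ, a, ha, rfl⟩
  exact D.comp_le ((S.restrictScalars ℂ).comap incl) (fun α x hx => h μ α hμ x hx.1 hx.2) ha

/-- The components are sub-superspaces, so generators may be taken parity-homogeneous, as Borcherds'
identity requires. -/
theorem J_le (S : Submodule ℂ[X] (Hb V))
    (h : ∀ (μ ν : M) (α β : ZMod 2), D.Balanced μ ν → ∀ a ∈ D.comp μ, a ∈ A.parity α →
      ∀ b ∈ D.comp ν, b ∈ A.parity β → D.P (-2 + D.χ μ ν) a b ∈ S) : D.J ≤ S := by
  refine Submodule.span_le.2 ?_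
  rintro _ ⟨μ, ν, hb, a, ha, b, hb', rfl⟩
  rw [prod_incl]
  refine D.comp_le ((S.restrictScalars ℂ).comap ((D.P _).flip b)) (fun α x hx => ?_) ha
  exact D.comp_le ((S.restrictScalars ℂ).comap (D.P _ x))
    (fun β y hy => h μ ν α β hb x hx.1 hx.2 y hy.1 hy.2) hb'

theorem T_mem {μ : M} {a : V} (ha : a ∈ D.comp μ) : A.T a ∈ D.comp (D.deg (-2) μ D.vacDeg) :=
  D.nth_mem (-2) ha D.vac_mem

/-- Descending induction on the mode. Passing from `a` to `Ta` keeps `ε` and raises the exponent by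
one, so `powProd_T` expresses a multiple of mode `n - 1` of `a` through mode `n` of `Ta` and of `a`.
-/
theorem P_mem_J {μ ν : M} (hb : D.Balanced μ ν) {a b : V} (ha : a ∈ D.comp μ)
    (hb' : b ∈ D.comp ν) {n : ℤ} (hn : n ≤ -2 + D.χ μ ν) : D.P n a b ∈ D.J := by
  obtain ⟨k, rfl⟩ : ∃ k : ℕ, n = -2 + D.χ μ ν - k := ⟨(-2 + D.χ μ ν - n).toNat, by omega⟩
  clear hn
  induction k generalizing μ a with
  | zero =>
    refine Submodule.subset_span ⟨μ, ν, hb, a, ha, b, hb', ?_⟩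
    rw [prod_incl]
    simp
  | succ k ih =>
    have hε := D.ε_deg_of_right (-2) μ D.ε_vacDeg
    have h1 := ih hb ha
    have h2 := ih (hb.congr hε rfl) (D.T_mem ha)
    have hwt : D.wt (D.deg (-2) μ D.vacDeg) = D.wt μ + 1 := by
      have := D.χ_of_right μ D.ε_vacDeg
      rw [χ] at this
      rw [D.wt_deg, this, D.wt_vacDeg]
      push_cast
      ring
    rw [D.χ_congr hε rfl, D.P_of_mem _ (D.T_mem ha), hwt, A.powProd_T] at h2
    rw [D.P_of_mem _ ha] at h1 ⊢
    have h3 := D.J.add_mem h2 (D.J.smul_of_tower_mem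
      (((-2 + D.χ μ ν - k : ℤ) : ℂ) + 1 + D.wt μ) (D.J.smul_mem (Polynomial.X : ℂ[X]) h1))
    rw [sub_add_cancel] at h3
    -- Since `χ ≤ 1`, the mode is at most `-1`, and one may divide by it.
    have hne : -((-2 + D.χ μ ν - k : ℤ) : ℂ) ≠ 0 := by
      rw [neg_ne_zero, Int.cast_ne_zero]
      rcases D.χ_eq μ ν with h | h <;> omega
    have h4 := D.J.smul_of_tower_mem (-((-2 + D.χ μ ν - k : ℤ) : ℂ))⁻¹ h3
    rw [inv_smul_smul₀ hne] at h4
    rw [show -2 + D.χ μ ν - ((k + 1 : ℕ) : ℤ) = -2 + D.χ μ ν - k - 1 by push_cast; ring]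
    exact h4

theorem powProd_mem_J {μ ν : M} (hb : D.Balanced μ ν) {a b : V} (ha : a ∈ D.comp μ)
    (hb' : b ∈ D.comp ν) {n : ℤ} (hn : n ≤ -2 + D.χ μ ν) : A.powProd (D.wt μ) n a b ∈ D.J := by
  rw [← D.P_of_mem _ ha]
  exact D.P_mem_J hb ha hb' hn

theorem P_mem_VG {μ ν : M} (hb : D.Balanced μ ν) {a b : V} (ha : a ∈ D.comp μ)
    (hb' : b ∈ D.comp ν) (n : ℤ) : D.P n a b ∈ D.VG := by
  rw [D.P_of_mem _ ha]
  exact A.powProd_mem _ _ fun j => D.incl_mem_VG (hb.ε_deg _) (D.nth_mem _ ha hb')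

theorem P_mem_VGParity {μ ν : M} (hb : D.Balanced μ ν) {a b : V} {α β : ZMod 2}
    (ha : a ∈ D.comp μ) (ha' : a ∈ A.parity α) (hb' : b ∈ D.comp ν) (hb'' : b ∈ A.parity β)
    (n : ℤ) : D.P n a b ∈ D.VGParity (α + β) := by
  rw [D.P_of_mem _ ha]
  exact A.powProd_mem _ _ fun j => D.incl_mem_VGParity (hb.ε_deg _)
    ⟨D.nth_mem _ ha hb', A.parity_preserving _ ha' hb''⟩

theorem J_le_VG : D.J ≤ D.VG :=
  D.J_le _ fun _ _ _ _ hb _ ha _ _ hb' _ => D.P_mem_VG hb ha hb' _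

theorem vac_mem_VG : incl A.vac ∈ D.VG := D.incl_mem_VG D.ε_vacDeg D.vac_mem

theorem bilin_mem (B : Hb V →ₗ[ℂ[X]] Hb V →ₗ[ℂ[X]] Hb V) {s t : Set (Hb V)}
    (S : Submodule ℂ[X] (Hb V)) (h : ∀ x ∈ s, ∀ y ∈ t, B x y ∈ S) {x y : Hb V}
    (hx : x ∈ Submodule.span ℂ[X] s) (hy : y ∈ Submodule.span ℂ[X] t) : B x y ∈ S := by
  have h1 : Submodule.span ℂ[X] s ≤ S.comap (B.flip y) := Submodule.span_le.2 fun x hx => by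
    have h2 : Submodule.span ℂ[X] t ≤ S.comap (B x) := Submodule.span_le.2 fun y hy => h x hx y hy
    exact h2 hy
  exact h1 hx

theorem prod_mem_VG (n : ℤ) {x y : Hb V} (hx : x ∈ D.VG) (hy : y ∈ D.VG) :
    D.prod n x y ∈ D.VG := by
  refine bilin_mem (D.prod n) D.VG ?_ hx hy
  rintro _ ⟨μ, hμ, a, ha, rfl⟩ _ ⟨ν, hν, b, hb, rfl⟩
  rw [prod_incl]
  exact D.P_mem_VG (D.balanced_of_eq_zero hμ hν) ha hb n

theorem bracket_incl (a b : V) :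
    D.bracket (incl a) (incl b) = ∑ᶠ j : ℕ, ((-Polynomial.X : ℂ[X]) ^ j) • D.P j a b := by
  rw [bracket, bilinExt_incl, bracketOf_apply]

theorem bracket_mem_VG {x y : Hb V} (hx : x ∈ D.VG) (hy : y ∈ D.VG) : D.bracket x y ∈ D.VG := by
  refine bilin_mem D.bracket D.VG ?_ hx hy
  rintro _ ⟨μ, hμ, a, ha, rfl⟩ _ ⟨ν, hν, b, hb, rfl⟩
  rw [bracket_incl]
  exact finsum_mem_submodule _ fun j => D.VG.smul_mem _
    (D.P_mem_VG (D.balanced_of_eq_zero hμ hν) ha hb j)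

theorem T_add_smul_mem_J {μ : M} (hμ : D.ε μ = 0) {a : V} (ha : a ∈ D.comp μ) :
    incl (A.T a) + (Polynomial.X : ℂ[X]) • D.wt μ • incl a ∈ D.J := by
  rw [← A.powProd_neg_two_vac]
  exact D.powProd_mem_J (D.balanced_of_eq_zero hμ D.ε_vacDeg) ha D.vac_mem
    (by rw [D.χ_of_left hμ]; rfl)

/-- The inner product `b_(q)c` is arbitrary: all its coefficients share the value `ε ν`, so the
outer mode of `a` alone forces membership in `J`. -/
theorem lift_powProd_mem_J {μ ν : M} (hb : D.Balanced μ ν) {a b c : V} (ha : a ∈ D.comp μ) {n : ℤ}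
    (hn : n ≤ -2 + D.χ μ ν) (q : ℤ) (x : ℂ) {ν₁ ν₂ : M} (hb₁ : b ∈ D.comp ν₁) (hc : c ∈ D.comp ν₂)
    (hν : ∀ k, D.ε (D.deg k ν₁ ν₂) = D.ε ν) :
    (A.powProd (D.wt μ) n a).liftBaseChange ℂ[X] (A.powProd x q b c) ∈ D.J := by
  refine A.powProd_mem (D.J.comap ((A.powProd (D.wt μ) n a).liftBaseChange ℂ[X])) x fun j => ?_
  rw [Submodule.mem_comap, liftBaseChange_incl]
  exact D.powProd_mem_J (hb.congr rfl (hν _)) ha (D.nth_mem _ hb₁ hc)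
    (by rw [D.χ_congr rfl (hν _)]; exact hn)

/-- The surplus `n + 1 - χ` does not depend on `r`, which lets all the terms of `iterProd` be
treated alike. -/
theorem wt_deg_sub (n : ℤ) (r : ℕ) (μ ν : M) :
    D.wt μ + D.wt ν - r = D.wt (D.deg (n + r) μ ν) + (n + 1 - D.χ μ ν : ℤ) := by
  rw [D.wt_deg, χ]
  push_cast
  ring

/-- Move `c_(-1)` past `a_(-2+χ)`. The swapped term has outer mode `-2 + χ`, and the commutator
terms are settled by counting modes. -/
theorem prod_mem_J_left {x v : Hb V} (hx : x ∈ D.J) (hv : v ∈ D.VG) : D.prod (-1) v x ∈ D.J := by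
  refine D.VG_le (D.J.comap ((D.prod (-1)).flip x)) (fun ρ γ hρ c hc hc' => ?_) hv
  refine D.J_le (D.J.comap (D.prod (-1) (incl c))) (fun μ ν α β hb a ha ha' b hb' hb'' => ?_) hx
  rw [Submodule.mem_comap, prod_incl_left, D.P_of_mem _ ha, D.P_of_mem _ hc]
  have h := A.powProd_commutator (D.wt ρ) (D.wt μ) (-1) (-2 + D.χ μ ν) b hc' ha'
  rw [sub_eq_iff_eq_add] at h
  rw [h]
  refine D.J.add_mem (finsum_mem_submodule _ fun j => D.J.smul_of_tower_mem _ ?_)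
    (D.J.smul_of_tower_mem _ (D.lift_powProd_mem_J hb ha le_rfl _ _ hc hb' fun k =>
      D.ε_deg_of_left k hρ ν))
  refine A.iterProd_mem _ fun r => ?_
  -- The mode is `-3 + χ - j` and the surplus is `j + 1`, so the largest mode reached is exactly `-2
  -- + χ`.
  rw [D.wt_deg_sub j, D.χ_of_left hρ, show ((j : ℤ) + 1 - 0) = ((j + 1 : ℕ) : ℤ) by simp,
    Int.cast_natCast]
  have hε := D.ε_deg_of_left (j + r) hρ μ
  refine A.powProd_add_nat_mem D.J (N := -2 + D.χ μ ν) (fun q hq => ?_) _ _ (by push_cast; omega)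
  exact D.powProd_mem_J (hb.congr hε rfl) (D.nth_mem _ hc ha) hb' (by rwa [D.χ_congr hε rfl])

/-- The left factor consists of the vectors `a_(n+r)b`, each used with its own exponent; the shift
`χ - n - 1` in the second exponent cancels the surplus. -/
theorem prod_P_incl {μ ν : M} {a b : V} (ha : a ∈ D.comp μ) (hb : b ∈ D.comp ν) (c : V)
    (n q : ℤ) : D.prod q (D.P n a b) (incl c)
      = A.iterProd (D.wt μ) (D.wt ν + (D.χ μ ν - n - 1 : ℤ)) n q a b c := by
  obtain ⟨L, hL⟩ := A.nth_finite n a b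
  rw [D.P_of_mem _ ha, A.powProd_apply, VertexAlgebra.iterProd,
    finsum_eq_sum_range (L := L) fun r hr => by rw [hL r hr]; simp,
    finsum_eq_sum_range (L := L) fun r hr => by rw [hL r hr]; simp, map_sum, LinearMap.sum_apply]
  refine Finset.sum_congr rfl fun r _ => ?_
  have hw : D.wt μ + (D.wt ν + (D.χ μ ν - n - 1 : ℤ)) - r = D.wt (D.deg (n + r) μ ν) := by
    rw [D.wt_deg, χ]
    push_cast
    ring
  rw [hw, ← D.P_of_mem _ (D.nth_mem _ ha hb), ← D.prod_incl, LinearMap.map_smul_of_tower,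
    LinearMap.smul_apply, map_smul, LinearMap.smul_apply]

theorem prod_mem_J_right {x v : Hb V} (hx : x ∈ D.J) (hv : v ∈ D.VG) : D.prod (-1) x v ∈ D.J := by
  refine D.VG_le (D.J.comap (D.prod (-1) x)) (fun ρ γ hρ c hc hc' => ?_) hv
  refine D.J_le (D.J.comap ((D.prod (-1)).flip (incl c)))
    (fun μ ν α β hb a ha ha' b hb' hb'' => ?_) hx
  rw [Submodule.mem_comap, LinearMap.flip_apply, D.prod_P_incl ha hb',
    show D.χ μ ν - (-2 + D.χ μ ν) - 1 = 1 by ring, Int.cast_one, A.iterProd_add_one]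
  -- The exponent of `b` is one too large for the iterate formula to involve only proper exponents.
  -- Pascal's rule removes this factor at the cost of the two modes `k = -1` and `k = 0`; for `k ≤
  -- 0` every outer mode is at most `-2 + χ`.
  have key : ∀ k : ℤ, k ≤ 0 →
      A.iterProd (D.wt μ) (D.wt ν) (-2 + D.χ μ ν) k a b c ∈ D.J := by
    intro k hk
    rw [← A.powProd_iterate _ _ _ _ _ ha' hb'']
    refine finsum_mem_submodule _ fun j => D.J.smul_of_tower_mem _ (D.J.sub_mem ?_
      (D.J.smul_of_tower_mem _ ?_))
    · exact D.lift_powProd_mem_J hb ha (by omega) _ _ hb' hc fun k => D.ε_deg_of_right k ν hρ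
    · have hb2 : D.Balanced ν μ := by rwa [Balanced, add_comm]
      have hχ : D.χ ν μ = D.χ μ ν := by simp only [χ, chi, add_comm]
      exact D.lift_powProd_mem_J hb2 hb' (by rw [hχ]; omega) _ _ ha hc fun k =>
        D.ε_deg_of_right k μ hρ
  exact D.J.add_mem (key _ (by norm_num)) (D.J.smul_mem _ (key _ (by norm_num)))

theorem prod_vac_left (x : Hb V) : D.prod (-1) (incl A.vac) x = x := by
  rw [prod_incl_left]
  induction x using Hb.incl_induction with
  | add x y hx hy => rw [map_add, hx, hy]
  | smul_incl p v =>
    rw [map_smul, liftBaseChange_incl, D.P_of_mem _ D.vac_mem, D.wt_vacDeg, A.powProd_zero,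
      A.nth_vac_left, if_pos rfl]

theorem P_vac_right (v : V) : D.P (-1) v A.vac = incl v := by
  have hv : v ∈ ⨆ μ, D.comp μ := D.iSup_comp ▸ Submodule.mem_top
  refine Submodule.iSup_induction D.comp (motive := fun v => D.P (-1) v A.vac = incl v) hv
    (fun μ x hx => ?_) (by simp) fun x y hx hy => ?_
  · rw [D.P_of_mem _ hx, A.powProd_neg_one_vac]
  · rw [map_add, LinearMap.add_apply, hx, hy, map_add]

theorem prod_vac_right (x : Hb V) : D.prod (-1) x (incl A.vac) = x := by
  induction x using Hb.incl_induction with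
  | add x y hx hy => rw [map_add, LinearMap.add_apply, hx, hy]
  | smul_incl p v => rw [map_smul, LinearMap.smul_apply, prod_incl, P_vac_right]

/-- Expanding the surplus by Pascal's rule, all modes are at most `-2` except the last, which is
`-1` and gives `ħ^e a_(-1)|0⟩ = ħ^e a`. -/
theorem powProd_vac_sub_mem_J {μ : M} (hμ : D.ε μ = 0) {a : V} (ha : a ∈ D.comp μ) (e : ℕ) :
    ∀ q : ℤ, q + e = -1 →
      A.powProd (D.wt μ + e) q a A.vac - (Polynomial.X ^ e : ℂ[X]) • incl a ∈ D.J := by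
  induction e with
  | zero =>
    intro q hq
    obtain rfl : q = -1 := by simpa using hq
    simp [A.powProd_neg_one_vac]
  | succ e ih =>
    intro q hq
    push_cast at hq ⊢
    have h1 : A.powProd (D.wt μ + e) q a A.vac ∈ D.J :=
      A.powProd_add_nat_mem D.J (N := -2) (fun q hq => D.powProd_mem_J
        (D.balanced_of_eq_zero hμ D.ε_vacDeg) ha D.vac_mem (by rwa [D.χ_of_left hμ])) e q (by omega)
    have h2 := ih (q + 1) (by omega)
    rw [← add_assoc, A.powProd_add_one, pow_succ', mul_smul, add_sub_assoc, ← smul_sub]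
    exact D.J.add_mem h1 (D.J.smul_mem _ h2)

theorem powProd_vac_mem_J {μ : M} (hμ : D.ε μ = 0) {a : V} (ha : a ∈ D.comp μ) (e : ℕ) {q : ℤ}
    (hq : q + e ≤ -2) : A.powProd (D.wt μ + e) q a A.vac ∈ D.J :=
  A.powProd_add_nat_mem D.J (N := -2) (fun q hq => D.powProd_mem_J
    (D.balanced_of_eq_zero hμ D.ε_vacDeg) ha D.vac_mem (by rwa [D.χ_of_left hμ])) e q hq

theorem iterProd_vac_sub_mem_J {μ ν : M} (hb : D.Balanced μ ν) {a b : V} (ha : a ∈ D.comp μ)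
    (hb' : b ∈ D.comp ν) (j : ℕ) :
    A.iterProd (D.wt μ) (D.wt ν) j (-2 - j) a b A.vac
      - ((1 - D.χ μ ν : ℤ) : ℂ) • (Polynomial.X ^ (j + 1) : ℂ[X]) • D.P j a b ∈ D.J := by
  obtain ⟨L, hL⟩ := A.nth_finite j a b
  rw [D.P_of_mem _ ha, A.powProd_apply, VertexAlgebra.iterProd,
    finsum_eq_sum_range (L := L) fun r hr => by rw [hL r hr]; simp,
    finsum_eq_sum_range (L := L) fun r hr => by rw [hL r hr]; simp, Finset.smul_sum,
    Finset.smul_sum, ← Finset.sum_sub_distrib]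
  refine D.J.sum_mem fun r _ => ?_
  set y := A.nth (j + r) a b with hy
  have hy' : y ∈ D.comp (D.deg (j + r) μ ν) := D.nth_mem _ ha hb'
  have hε := hb.ε_deg (j + r)
  have key : A.powProd (D.wt μ + D.wt ν - r) (-2 - j) y A.vac
      - ((1 - D.χ μ ν : ℤ) : ℂ) • (Polynomial.X ^ (j + 1) : ℂ[X]) • incl y ∈ D.J := by
    rw [D.wt_deg_sub j]
    -- For `χ = 0` the surplus `j + 1` lifts the mode `-2 - j` to `-1`, leaving `ħ^(j+1) y`. For `χ
    -- = 1` the surplus is `j`, the mode stops at `-2`, and nothing is left modulo `J`.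
    rcases D.χ_eq μ ν with h | h
    · rw [h, show ((j : ℤ) + 1 - 0) = ((j + 1 : ℕ) : ℤ) by simp, Int.cast_natCast, sub_zero,
        Int.cast_one, one_smul]
      exact D.powProd_vac_sub_mem_J hε hy' _ _ (by push_cast; ring)
    · rw [h, show ((j : ℤ) + 1 - 1) = (j : ℤ) by simp, Int.cast_natCast, sub_self,
        Int.cast_zero, zero_smul, sub_zero]
      exact D.powProd_vac_mem_J hε hy' _ (by omega)
  have := D.J.smul_of_tower_mem (Ring.choose (D.wt μ) r)
    (D.J.smul_mem (Polynomial.X ^ r : ℂ[X]) key)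
  rw [smul_sub, smul_sub] at this
  convert this using 2
  rw [smul_comm (Polynomial.X ^ r : ℂ[X]) ((1 - D.χ μ ν : ℤ) : ℂ),
    smul_comm (Polynomial.X ^ r : ℂ[X]) (Polynomial.X ^ (j + 1) : ℂ[X]),
    smul_comm (Ring.choose _ r) ((1 - D.χ μ ν : ℤ) : ℂ),
    smul_comm (Ring.choose _ r) (Polynomial.X ^ (j + 1) : ℂ[X])]

/-- Skew-symmetry modulo `J`. -/
theorem skew_mem_J {μ ν : M} (hb : D.Balanced μ ν) {α β : ZMod 2} {a b : V} (ha : a ∈ D.comp μ)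
    (ha' : a ∈ A.parity α) (hb' : b ∈ D.comp ν) (hb'' : b ∈ A.parity β) :
    D.prod (-1) (incl a) (incl b) - sgn α β • D.prod (-1) (incl b) (incl a)
      - ((1 - D.χ μ ν : ℤ) : ℂ) • (Polynomial.X : ℂ[X]) • D.bracket (incl a) (incl b) ∈ D.J := by
  -- On the vacuum the inner modes `-1` return `b` and `a`, so the left side becomes the
  -- supercommutator of `a` and `b`.
  have h := A.powProd_commutator (D.wt μ) (D.wt ν) (-1) (-1) A.vac ha' hb''
  rw [A.powProd_neg_one_vac, A.powProd_neg_one_vac, liftBaseChange_incl, liftBaseChange_incl] at h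
  obtain ⟨L₁, h₁⟩ := D.P_eventually_zero a b
  obtain ⟨L₂, h₂⟩ := A.iterProd_eventually_zero (D.wt μ) (D.wt ν) 0 a b A.vac
  rw [prod_incl, prod_incl, D.P_of_mem _ ha, D.P_of_mem _ hb', h, bracket_incl,
    finsum_eq_sum_range (L := max L₁ L₂) fun j hj => by
      have := h₂ (-1 + -1 - j) j (by omega)
      rw [zero_add] at this
      rw [this, smul_zero],
    finsum_eq_sum_range (L := max L₁ L₂) fun j hj => by rw [h₁ j (by omega), smul_zero],
    Finset.smul_sum, Finset.smul_sum, ← Finset.sum_sub_distrib]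
  refine D.J.sum_mem fun j _ => ?_
  have := D.J.smul_of_tower_mem ((-1 : ℂ) ^ j) (D.iterProd_vac_sub_mem_J hb ha hb' j)
  rw [smul_sub] at this
  convert this using 2
  · rw [Int.cast_neg, Int.cast_one, choose_neg_one]
    rfl
  · rw [smul_comm ((-1 : ℂ) ^ j)]
    congr 1
    rw [smul_smul, neg_pow, pow_succ', ← smul_assoc, Polynomial.smul_eq_C_mul]
    congr 1
    simp
    ring

theorem skew_mem_J_of_mem_VGParity {α β : ZMod 2} {x y : Hb V} (hx : x ∈ D.VGParity α)
    (hy : y ∈ D.VGParity β) :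
    D.prod (-1) x y - sgn α β • D.prod (-1) y x - (Polynomial.X : ℂ[X]) • D.bracket x y ∈ D.J := by
  refine bilin_mem (D.prod (-1) - sgn α β • (D.prod (-1)).flip
    - (Polynomial.X : ℂ[X]) • D.bracket) D.J ?_ hx hy
  rintro _ ⟨μ, hμ, a, ha, rfl⟩ _ ⟨ν, hν, b, hb, rfl⟩
  have := D.skew_mem_J (D.balanced_of_eq_zero hμ hν) ha.1 ha.2 hb.1 hb.2
  rw [D.χ_of_left hμ, sub_zero, Int.cast_one, one_smul] at this
  exact this

theorem bracket_mem_J_right {x v : Hb V} (hx : x ∈ D.J) (hv : v ∈ D.VG) :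
    (Polynomial.X : ℂ[X]) • D.bracket x v ∈ D.J := by
  refine D.VG_le (D.J.comap ((Polynomial.X : ℂ[X]) • D.bracket x)) (fun ρ γ hρ c hc hc' => ?_) hv
  refine D.J_le (D.J.comap (((Polynomial.X : ℂ[X]) • D.bracket).flip (incl c)))
    (fun μ ν α β hb a ha ha' b hb' hb'' => ?_) hx
  have hJ : D.P (-2 + D.χ μ ν) a b ∈ D.J := D.P_mem_J hb ha hb' le_rfl
  have hc1 := D.incl_mem_VG hρ hc
  have h := D.skew_mem_J_of_mem_VGParity (D.P_mem_VGParity hb ha ha' hb' hb'' (-2 + D.χ μ ν))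
    (D.incl_mem_VGParity hρ ⟨hc, hc'⟩)
  -- Both orders of the product lie in `J`, so skew-symmetry leaves the multiple `ħ` of the bracket
  -- in `J`. A generator of `J` has `ε = 0`, so `χ` vanishes here.
  have h2 := D.J.sub_mem (D.J.sub_mem (D.prod_mem_J_right hJ hc1)
    (D.J.smul_of_tower_mem (sgn (α + β) γ) (D.prod_mem_J_left hJ hc1))) h
  rw [sub_sub_cancel] at h2
  exact h2

theorem bracket_mem_J_left {x v : Hb V} (hx : x ∈ D.J) (hv : v ∈ D.VG) :
    (Polynomial.X : ℂ[X]) • D.bracket v x ∈ D.J := by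
  refine D.VG_le (D.J.comap (((Polynomial.X : ℂ[X]) • D.bracket).flip x))
    (fun ρ γ hρ c hc hc' => ?_) hv
  refine D.J_le (D.J.comap ((Polynomial.X : ℂ[X]) • D.bracket (incl c)))
    (fun μ ν α β hb a ha ha' b hb' hb'' => ?_) hx
  have hJ : D.P (-2 + D.χ μ ν) a b ∈ D.J := D.P_mem_J hb ha hb' le_rfl
  have hc1 := D.incl_mem_VG hρ hc
  have h := D.skew_mem_J_of_mem_VGParity (D.incl_mem_VGParity hρ ⟨hc, hc'⟩)
    (D.P_mem_VGParity hb ha ha' hb' hb'' (-2 + D.χ μ ν))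
  have h2 := D.J.sub_mem (D.J.sub_mem (D.prod_mem_J_left hJ hc1)
    (D.J.smul_of_tower_mem (sgn γ (α + β)) (D.prod_mem_J_right hJ hc1))) h
  rw [sub_sub_cancel] at h2
  exact h2

/-- With `χ = 0` and `n = -1` the surplus is zero, so `(a_(-1)b)_(-1)c` is given exactly by the
iterate formula. Apart from `a_(-1)(b_(-1)c)`, every term has outer mode at most `-2`. -/
theorem assoc_mem_J {x y z : Hb V} (hx : x ∈ D.VG) (hy : y ∈ D.VG) (hz : z ∈ D.VG) :
    D.prod (-1) (D.prod (-1) x y) z - D.prod (-1) x (D.prod (-1) y z) ∈ D.J := by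
  refine D.VG_le (D.J.comap ((D.prod (-1)).flip z ∘ₗ (D.prod (-1)).flip y
    - (D.prod (-1)).flip (D.prod (-1) y z))) (fun μ α hμ a ha ha' => ?_) hx
  refine D.VG_le (D.J.comap ((D.prod (-1)).flip z ∘ₗ D.prod (-1) (incl a)
    - D.prod (-1) (incl a) ∘ₗ (D.prod (-1)).flip z)) (fun ν β hν b hb hb' => ?_) hy
  refine D.VG_le (D.J.comap (D.prod (-1) (D.prod (-1) (incl a) (incl b))
    - D.prod (-1) (incl a) ∘ₗ D.prod (-1) (incl b))) (fun ρ γ hρ c hc hc' => ?_) hz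
  show D.prod (-1) (D.prod (-1) (incl a) (incl b)) (incl c)
    - D.prod (-1) (incl a) (D.prod (-1) (incl b) (incl c)) ∈ D.J
  rw [prod_incl, prod_incl, D.prod_P_incl ha hb, prod_incl_left, D.χ_of_left hμ,
    show (0 : ℤ) - -1 - 1 = 0 by norm_num, Int.cast_zero, add_zero,
    ← A.powProd_iterate _ _ _ _ _ ha' hb', D.P_of_mem _ ha, D.P_of_mem _ hb]
  obtain ⟨L, hL⟩ := A.powProd_iterate_eventually_zero (D.wt μ) (D.wt ν) (-1) (-1)
    ((-1 : ℂ) ^ (-1 : ℤ) * sgn α β) a b c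
  have h2 : ∀ j : ℕ, (A.powProd (D.wt ν) (-1 + -1 - j) b).liftBaseChange ℂ[X]
      (A.powProd (D.wt μ) j a c) ∈ D.J := fun j =>
    D.lift_powProd_mem_J (D.balanced_of_eq_zero hν hρ) hb (by rw [D.χ_of_left hν]; omega) _ _ ha hc
      fun k => D.ε_deg_of_left k hμ ρ
  -- The term `j = 0` is split off: it contains `a_(-1)(b_(-1)c)`, which cancels the subtracted
  -- product.
  rw [finsum_eq_sum_range (L := L + 1) fun j hj => hL j (by omega), Finset.sum_range_succ',
    add_sub_assoc]
  refine D.J.add_mem (D.J.sum_mem fun j _ => D.J.smul_of_tower_mem _ (D.J.sub_mem ?_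
    (D.J.smul_of_tower_mem _ (h2 _)))) ?_
  · exact D.lift_powProd_mem_J (D.balanced_of_eq_zero hμ hρ) ha
      (by rw [D.χ_of_left hμ]; push_cast; omega) _ _ hb hc fun k => D.ε_deg_of_left k hν ρ
  · have h3 := D.J.neg_mem (D.J.smul_of_tower_mem ((-1 : ℂ) ^ (-1 : ℤ) * sgn α β) (h2 0))
    simpa using h3

end HomogData

end

end ZhuAlg

/-! ### Superalgebra structure on quotients and compatibility with parity. -/

namespace ZhuAlg

noncomputable section

section Quotient

theorem isInternal_of_projections {R Q ι : Type*} [Ring R] [AddCommGroup Q] [Module R Q]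
    [Fintype ι] [DecidableEq ι] (p : ι → Submodule R Q) (q : ι → Q →ₗ[R] Q)
    (hmem : ∀ i x, q i x ∈ p i) (hq : ∀ i j x, x ∈ p j → q i x = if j = i then x else 0)
    (hsum : ∀ x, ∑ i, q i x = x) : DirectSum.IsInternal p := by
  rw [DirectSum.isInternal_submodule_iff_iSupIndep_and_iSup_eq_top]
  constructor
  · rw [iSupIndep_def]
    intro i
    rw [Submodule.disjoint_def]
    intro x hx hx'
    have h1 : ⨆ j, ⨆ (_ : j ≠ i), p j ≤ LinearMap.ker (q i) :=
      iSup_le fun j => iSup_le fun hj y hy => by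
        rw [LinearMap.mem_ker, hq i j y hy, if_neg hj]
    have h2 := h1 hx'
    rwa [LinearMap.mem_ker, hq i i x hx, if_pos rfl] at h2
  · rw [eq_top_iff]
    intro x _
    rw [← hsum x]
    exact Submodule.sum_mem _ fun i _ => Submodule.mem_iSup_of_mem i (hmem i x)

variable {M : Type u} [AddCommGroup M] [Module ℂ[X] M]

/-- The bilinear map induced on the quotient by a two-sided ideal. -/
def quotientMul (B : M →ₗ[ℂ[X]] M →ₗ[ℂ[X]] M) (J : Submodule ℂ[X] M)
    (hl : ∀ v, ∀ x ∈ J, B v x ∈ J) (hr : ∀ x ∈ J, ∀ v, B x v ∈ J) :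
    M ⧸ J →ₗ[ℂ[X]] M ⧸ J →ₗ[ℂ[X]] M ⧸ J :=
  J.liftQ
    { toFun := fun x => J.mapQ J (B x) (hl x)
      map_add' := fun x y => by ext z; simp
      map_smul' := fun c x => by ext z; simp }
    (fun x hx => by
      rw [LinearMap.mem_ker]
      ext z
      simpa using hr x hx z)

theorem quotientMul_mk (B : M →ₗ[ℂ[X]] M →ₗ[ℂ[X]] M) (J : Submodule ℂ[X] M)
    (hl : ∀ v, ∀ x ∈ J, B v x ∈ J) (hr : ∀ x ∈ J, ∀ v, B x v ∈ J) (x y : M) :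
    quotientMul B J hl hr (J.mkQ x) (J.mkQ y) = J.mkQ (B x y) := rfl

theorem isSuperalgebra_of_bilinear {Q : Type u} [AddCommGroup Q] [Module ℂ[X] Q]
    (B : Q →ₗ[ℂ[X]] Q →ₗ[ℂ[X]] Q) (one : Q) (par : ZMod 2 → Submodule ℂ[X] Q)
    (one_mul : ∀ x, B one x = x) (mul_one : ∀ x, B x one = x)
    (assoc : ∀ x y z, B (B x y) z = B x (B y z)) (one_mem : one ∈ par 0)
    (mul_mem : ∀ {α β x y}, x ∈ par α → y ∈ par β → B x y ∈ par (α + β))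
    (internal : DirectSum.IsInternal par) : IsSuperalgebra (fun x y => B x y) one par := by
  let R : Ring Q :=
    { (inferInstance : AddCommGroup Q) with
      mul := fun x y => B x y
      one := one
      left_distrib := fun x y z => (B x).map_add y z
      right_distrib := fun x y z => B.map_add₂ x y z
      zero_mul := fun x => B.map_zero₂ x
      mul_zero := fun x => (B x).map_zero
      mul_assoc := assoc
      one_mul := one_mul
      mul_one := mul_one }
  let alg : Algebra ℂ[X] Q := Algebra.ofModule
    (fun r x y => B.map_smul₂ r x y) (fun r x y => (B x).map_smul r y)
  refine ⟨Q, R, alg, LinearEquiv.refl ℂ[X] Q, fun _ _ => rfl, rfl, ?_⟩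
  have hmap : (fun α => (par α).map (LinearEquiv.refl ℂ[X] Q).toLinearMap) = par := by
    funext α
    exact Submodule.map_id _
  rw [hmap]
  exact ⟨{ internal.chooseDecomposition with
    one_mem := one_mem
    mul_mem := fun _ _ _ _ hx hy => mul_mem hx hy }⟩

/-- Associativity is needed only modulo `J`. As `J` is stable under the parity projections, they
descend and split the quotient. -/
theorem isSuperalgebra_quotient (B : M →ₗ[ℂ[X]] M →ₗ[ℂ[X]] M) (J : Submodule ℂ[X] M) (one : M)
    (p : ZMod 2 → Submodule ℂ[X] M) (π : ZMod 2 → M →ₗ[ℂ[X]] M)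
    (hl : ∀ v, ∀ x ∈ J, B v x ∈ J) (hr : ∀ x ∈ J, ∀ v, B x v ∈ J)
    (one_mul : ∀ x, B one x = x) (mul_one : ∀ x, B x one = x)
    (assoc : ∀ x y z, B (B x y) z - B x (B y z) ∈ J) (one_mem : one ∈ p 0)
    (mul_mem : ∀ {α β x y}, x ∈ p α → y ∈ p β → B x y ∈ p (α + β))
    (hmem : ∀ α x, π α x ∈ p α) (hπ : ∀ α β x, x ∈ p β → π α x = if β = α then x else 0)
    (hsum : ∀ x, ∑ α, π α x = x) (hJ : ∀ α, ∀ x ∈ J, π α x ∈ J) :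
    IsSuperalgebra (fun x y => quotientMul B J hl hr x y) (J.mkQ one)
      fun α => (p α).map J.mkQ := by
  have hs := J.mkQ_surjective
  refine isSuperalgebra_of_bilinear _ _ _ (hs.forall.2 fun x => ?_) (hs.forall.2 fun x => ?_)
    (hs.forall.2 fun x => hs.forall.2 fun y => hs.forall.2 fun z => ?_) ⟨one, one_mem, rfl⟩ ?_ ?_
  · rw [quotientMul_mk, one_mul]
  · rw [quotientMul_mk, mul_one]
  · simp only [quotientMul_mk]
    exact (Submodule.Quotient.eq J).2 (assoc x y z)
  · rintro α β _ _ ⟨x, hx, rfl⟩ ⟨y, hy, rfl⟩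
    exact ⟨B x y, mul_mem hx hy, rfl⟩
  · refine isInternal_of_projections _ (fun α => J.mapQ J (π α) (hJ α)) (fun α => ?_)
      (fun α β => ?_) (hs.forall.2 fun x => ?_)
    · exact hs.forall.2 fun x => ⟨π α x, hmem α x, rfl⟩
    · rintro _ ⟨x, hx, rfl⟩
      show J.mkQ (π α x) = _
      rw [hπ α β x hx]
      split_ifs <;> simp
    · show ∑ α, J.mkQ (π α x) = _
      rw [← map_sum, hsum]

end Quotient

variable {V : Type u} [AddCommGroup V] [Module ℂ V]

section InternalProj

variable {ι : Type*} [DecidableEq ι] {𝒜 : ι → Submodule ℂ V}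

theorem internal_induction (h : DirectSum.IsInternal 𝒜) {S : Submodule ℂ V} (hS : ∀ i, 𝒜 i ≤ S) (a : V) : a ∈ S :=
  (iSup_le hS : ⨆ i, 𝒜 i ≤ S) (h.submodule_iSup_eq_top ▸ Submodule.mem_top)

variable (h : DirectSum.IsInternal 𝒜)

/-- The projection of `V = ⨁ 𝒜 i` to its summand `𝒜 i`. -/
def internalProj (i : ι) : V →ₗ[ℂ] V :=
  extend 𝒜 h fun j => if j = i then LinearMap.id else 0

theorem internalProj_of_mem (i : ι) {j : ι} {a : V} (ha : a ∈ 𝒜 j) :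
    internalProj h i a = if j = i then a else 0 := by
  rw [internalProj, extend_of_mem _ _ _ ha]
  split_ifs <;> rfl

theorem internalProj_mem (i : ι) (a : V) : internalProj h i a ∈ 𝒜 i := by
  refine internal_induction h (S := (𝒜 i).comap (internalProj h i)) (fun j a ha => ?_) a
  rw [Submodule.mem_comap, internalProj_of_mem h i ha]
  split_ifs with hj
  · exact hj ▸ ha
  · exact Submodule.zero_mem _

theorem internalProj_comm {f : V →ₗ[ℂ] V} (hf : ∀ i, ∀ a ∈ 𝒜 i, f a ∈ 𝒜 i) (i : ι) (a : V) :
    f (internalProj h i a) = internalProj h i (f a) := by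
  have := internal_induction h (S := LinearMap.ker (f ∘ₗ internalProj h i
    - internalProj h i ∘ₗ f)) (fun j a ha => ?_) a
  · exact sub_eq_zero.1 this
  · rw [LinearMap.mem_ker, LinearMap.sub_apply, LinearMap.comp_apply, LinearMap.comp_apply,
      internalProj_of_mem h i ha, internalProj_of_mem h i (hf j a ha)]
    split_ifs <;> simp

end InternalProj

namespace VertexAlgebra

variable (A : VertexAlgebra V)

/-- The projection of `V` to its part of parity `α`. -/
def parityProj (α : ZMod 2) : V →ₗ[ℂ] V :=
  internalProj A.parity_internal α

theorem parityProj_of_mem (α : ZMod 2) {β : ZMod 2} {a : V} (ha : a ∈ A.parity β) :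
    A.parityProj α a = if β = α then a else 0 := internalProj_of_mem _ α ha

theorem parityProj_mem (α : ZMod 2) (a : V) : A.parityProj α a ∈ A.parity α :=
  internalProj_mem _ α a

theorem sum_parityProj (a : V) : ∑ α, A.parityProj α a = a := by
  induction a using A.parity_induction with
  | zero => simp
  | add x y hx hy => simp only [map_add, Finset.sum_add_distrib, hx, hy]
  | mem β a ha => simp [A.parityProj_of_mem _ ha]

theorem IsSubSuperspace.parityProj_mem {A : VertexAlgebra V} {S : Submodule ℂ V}
    (hS : A.IsSubSuperspace S) (α : ZMod 2) {a : V} (ha : a ∈ S) : A.parityProj α a ∈ S := by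
  have h : ⨆ β, S ⊓ A.parity β ≤ S.comap (A.parityProj α) := iSup_le fun β x hx => by
    rw [Submodule.mem_comap, A.parityProj_of_mem α hx.2]
    split_ifs
    · exact hx.1
    · exact S.zero_mem
  exact h (hS ha)

theorem isSubSuperspace_of_parityProj {S : Submodule ℂ V}
    (hS : ∀ (α : ZMod 2), ∀ a ∈ S, A.parityProj α a ∈ S) : A.IsSubSuperspace S := fun a ha => by
  rw [← A.sum_parityProj a]
  exact Submodule.sum_mem _ fun α _ =>
    Submodule.mem_iSup_of_mem α ⟨hS α a ha, A.parityProj_mem α a⟩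

/-- The projection of `V[ħ]` to its part of parity `α`. -/
def parityProjHb (α : ZMod 2) : Hb V →ₗ[ℂ[X]] Hb V := (A.parityProj α).baseChange ℂ[X]

theorem parityProjHb_incl (α : ZMod 2) (a : V) :
    A.parityProjHb α (incl a) = incl (A.parityProj α a) := by
  simp [parityProjHb, incl]

theorem incl_mem_parityHb {α : ZMod 2} {a : V} (ha : a ∈ A.parity α) : incl a ∈ A.parityHb α :=
  Submodule.tmul_mem_baseChange_of_mem 1 ha

theorem parityHb_eq_span (α : ZMod 2) :
    A.parityHb α = Submodule.span ℂ[X] (incl '' (A.parity α : Set V)) := by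
  rw [parityHb, Submodule.baseChange_eq_span]
  rfl

theorem parityHb_le {α : ZMod 2} (S : Submodule ℂ[X] (Hb V))
    (h : ∀ a ∈ A.parity α, incl a ∈ S) : A.parityHb α ≤ S := by
  rw [parityHb_eq_span]
  refine Submodule.span_le.2 ?_
  rintro _ ⟨a, ha, rfl⟩
  exact h a ha

theorem parityProjHb_mem (α : ZMod 2) (x : Hb V) : A.parityProjHb α x ∈ A.parityHb α := by
  have := Hb.span_incl ((A.parityHb α).comap (A.parityProjHb α)) fun v => by
    rw [Submodule.mem_comap, parityProjHb_incl]
    exact A.incl_mem_parityHb (A.parityProj_mem α v)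
  exact (this ▸ Submodule.mem_top : x ∈ (A.parityHb α).comap (A.parityProjHb α))

theorem parityProjHb_of_mem (α : ZMod 2) {β : ZMod 2} {x : Hb V} (hx : x ∈ A.parityHb β) :
    A.parityProjHb α x = if β = α then x else 0 := by
  have h : A.parityHb β ≤ LinearMap.ker
      (A.parityProjHb α - if β = α then LinearMap.id else 0) :=
    A.parityHb_le _ fun a ha => by
      rw [LinearMap.mem_ker, LinearMap.sub_apply, parityProjHb_incl, A.parityProj_of_mem α ha]
      split_ifs <;> simp
  have := h hx
  rw [LinearMap.mem_ker, LinearMap.sub_apply, sub_eq_zero] at this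
  rw [this]
  split_ifs <;> rfl

theorem sum_parityProjHb (x : Hb V) : ∑ α, A.parityProjHb α x = x := by
  induction x using Hb.incl_induction with
  | add x y hx hy => simp only [map_add, Finset.sum_add_distrib, hx, hy]
  | smul_incl p v =>
    simp only [map_smul, parityProjHb_incl]
    rw [← Finset.smul_sum, ← map_sum, A.sum_parityProj]

end VertexAlgebra

namespace HomogData

variable {A : VertexAlgebra V} {M : Type v} (D : HomogData A M)

theorem parity_le (S : Submodule ℂ V) {α : ZMod 2} (h : ∀ μ, D.comp μ ⊓ A.parity α ≤ S) :
    A.parity α ≤ S := fun a ha => by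
  have h1 : ⨆ μ, D.comp μ ≤ S.comap (A.parityProj α) := iSup_le fun μ x hx =>
    h μ ⟨(D.comp_super μ).parityProj_mem α hx, A.parityProj_mem α x⟩
  have h2 : a ∈ S.comap (A.parityProj α) := h1 (D.iSup_comp ▸ Submodule.mem_top)
  rwa [Submodule.mem_comap, A.parityProj_of_mem α ha, if_pos rfl] at h2

theorem P_mem_parityHb (n : ℤ) {α β : ZMod 2} {a b : V} (ha : a ∈ A.parity α)
    (hb : b ∈ A.parity β) : D.P n a b ∈ A.parityHb (α + β) := by
  refine D.parity_le (((A.parityHb (α + β)).restrictScalars ℂ).comap ((D.P n).flip b))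
    (fun μ x hx => ?_) ha
  show D.P n x b ∈ A.parityHb (α + β)
  rw [D.P_of_mem _ hx.1]
  exact A.powProd_mem _ _ fun j => A.incl_mem_parityHb (A.parity_preserving _ hx.2 hb)

theorem prod_mem_parityHb (n : ℤ) {α β : ZMod 2} {x y : Hb V} (hx : x ∈ A.parityHb α)
    (hy : y ∈ A.parityHb β) : D.prod n x y ∈ A.parityHb (α + β) := by
  rw [A.parityHb_eq_span] at hx hy
  refine bilin_mem (D.prod n) _ ?_ hx hy
  rintro _ ⟨a, ha, rfl⟩ _ ⟨b, hb, rfl⟩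
  rw [prod_incl]
  exact D.P_mem_parityHb n ha hb

theorem parityProjHb_mem_VGParity (α : ZMod 2) {x : Hb V} (hx : x ∈ D.VG) :
    A.parityProjHb α x ∈ D.VGParity α := by
  refine D.VG_le ((D.VGParity α).comap (A.parityProjHb α)) (fun μ β hμ a ha ha' => ?_) hx
  rw [Submodule.mem_comap, A.parityProjHb_of_mem α (A.incl_mem_parityHb ha')]
  split_ifs with h
  · exact D.incl_mem_VGParity hμ ⟨ha, h ▸ ha'⟩
  · exact Submodule.zero_mem _

theorem VGParity_le_VG (α : ZMod 2) : D.VGParity α ≤ D.VG := by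
  refine Submodule.span_le.2 ?_
  rintro _ ⟨μ, hμ, a, ha, rfl⟩
  exact D.incl_mem_VG hμ ha.1

theorem parityProjHb_mem_VG (α : ZMod 2) {x : Hb V} (hx : x ∈ D.VG) :
    A.parityProjHb α x ∈ D.VG := D.VGParity_le_VG α (D.parityProjHb_mem_VGParity α hx)

theorem mem_VGParity {α : ZMod 2} {x : Hb V} (hx : x ∈ D.VG) (hα : x ∈ A.parityHb α) :
    x ∈ D.VGParity α := by
  have := D.parityProjHb_mem_VGParity α hx
  rwa [A.parityProjHb_of_mem α hα, if_pos rfl] at this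

theorem parityProjHb_mem_J (α : ZMod 2) {x : Hb V} (hx : x ∈ D.J) :
    A.parityProjHb α x ∈ D.J := by
  refine D.J_le (D.J.comap (A.parityProjHb α)) (fun μ ν β γ hb a ha ha' b hb' hb'' => ?_) hx
  rw [Submodule.mem_comap, A.parityProjHb_of_mem α (D.P_mem_parityHb _ ha' hb'')]
  split_ifs with h
  · exact D.P_mem_J hb ha hb' le_rfl
  · exact Submodule.zero_mem _

/-- The deformed `(-1)`-product on the span of the homogeneous vectors `a` with `ε_a = 0`. -/
def prodVG : D.VG →ₗ[ℂ[X]] D.VG →ₗ[ℂ[X]] D.VG :=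
  LinearMap.mk₂ ℂ[X] (fun x y => ⟨D.prod (-1) x y, D.prod_mem_VG (-1) x.2 y.2⟩)
    (fun x x' y => Subtype.ext (by simp)) (fun c x y => Subtype.ext (by simp))
    (fun x y y' => Subtype.ext (by simp)) (fun c x y => Subtype.ext (by simp))

/-- `J` and `W` are only assumed equal to `D.J` and `D.VG`, so that the result applies to spans
defined independently of `D`. Representing the product by a given `z` in `W` keeps closure out of
the statement. -/
theorem exists_zhu {J W : Submodule ℂ[X] (Hb V)} (hJ : J = D.J) (hW : W = D.VG) :
    ∃ (mul : W ⧸ J.submoduleOf W → W ⧸ J.submoduleOf W →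
      W ⧸ J.submoduleOf W) (one : W ⧸ J.submoduleOf W),
    (∀ x y z : W, (z : Hb V) = D.prod (-1) x y →
      mul ((J.submoduleOf W).mkQ x) ((J.submoduleOf W).mkQ y)
        = (J.submoduleOf W).mkQ z) ∧
    (∀ u : W, (u : Hb V) = incl A.vac → (J.submoduleOf W).mkQ u = one) ∧
    IsSuperalgebra mul one fun α =>
      ((A.parityHb α).submoduleOf W).map (J.submoduleOf W).mkQ := by
  subst hJ hW
  refine ⟨_, _, fun x y z hz => ?_, fun u hu => ?_, isSuperalgebra_quotient D.prodVG
    (D.J.submoduleOf D.VG) ⟨incl A.vac, D.vac_mem_VG⟩ (fun α => (A.parityHb α).submoduleOf D.VG)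
    (fun α => (A.parityProjHb α).restrict fun x hx => D.parityProjHb_mem_VG α hx)
    (fun v x hx => D.prod_mem_J_left hx v.2) (fun x hx v => D.prod_mem_J_right hx v.2)
    (fun x => Subtype.ext (D.prod_vac_left x)) (fun x => Subtype.ext (D.prod_vac_right x))
    (fun x y z => D.assoc_mem_J x.2 y.2 z.2) (A.incl_mem_parityHb A.vac_even)
    (fun hx hy => D.prod_mem_parityHb (-1) hx hy) (fun α x => A.parityProjHb_mem α x)
    (fun α β x hx => Subtype.ext ?_) (fun x => Subtype.ext ?_)
    (fun α x hx => D.parityProjHb_mem_J α hx)⟩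
  · exact congrArg (D.J.submoduleOf D.VG).mkQ
      (show D.prodVG x y = z from Subtype.ext hz.symm)
  · exact congrArg _ (Subtype.ext hu)
  · have := A.parityProjHb_of_mem α (x := (x : Hb V)) hx
    rw [LinearMap.restrict_apply]
    split_ifs with h <;> simpa [h] using this
  · simpa [Submodule.coe_sum] using A.sum_parityProjHb (x : Hb V)

end HomogData

end

end ZhuAlg

/-! ### The two instances: eigenspaces of `H`, and components of given degree and weight. -/

namespace ZhuAlg

noncomputable section

variable {V : Type u} [AddCommGroup V] [Module ℂ V]

namespace Hamiltonian

variable {A : VertexAlgebra V} (K : Hamiltonian A)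

theorem nth_mem_eigenspace (n : ℤ) {Δ Δ' : ℂ} {a b : V} (ha : a ∈ K.H.eigenspace Δ)
    (hb : b ∈ K.H.eigenspace Δ') : A.nth n a b ∈ K.H.eigenspace (Δ + Δ' - n - 1) := by
  rw [Module.End.mem_eigenspace_iff] at *
  have h := K.commutator n a b
  rw [ha, hb, map_smul, map_smul, LinearMap.smul_apply, sub_eq_iff_eq_add] at h
  rw [h]
  module

theorem vac_mem_eigenspace : A.vac ∈ K.H.eigenspace 0 := by
  rw [Module.End.mem_eigenspace_iff, zero_smul]
  have h := K.commutator (-1) A.vac A.vac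
  rw [A.nth_vac_left, A.nth_vac_left, A.nth_vac_right _ le_rfl, if_pos rfl] at h
  simpa using h.symm

theorem H_parityProj (α : ZMod 2) (a : V) : K.H (A.parityProj α a) = A.parityProj α (K.H a) :=
  internalProj_comm _ (fun _ _ ha => K.even ha) α a

theorem parityProj_mem_eigenspace (α : ZMod 2) {Δ : ℂ} {a : V} (ha : a ∈ K.H.eigenspace Δ) :
    A.parityProj α a ∈ K.H.eigenspace Δ := by
  rw [Module.End.mem_eigenspace_iff] at *
  rw [H_parityProj, ha, map_smul]

theorem prodV_of_mem (n : ℤ) {Δ : ℂ} {a : V} (ha : a ∈ K.H.eigenspace Δ) :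
    K.prodV n a = A.powProd Δ n a :=
  extend_of_mem _ K.diagonalizable _ ha

theorem iSup_eigenspace : ⨆ Δ : ℂ, K.H.eigenspace Δ = ⊤ := K.diagonalizable.submodule_iSup_eq_top

/-- The eigenspaces of a Hamiltonian operator, with `γ_a = Δ_a` and `ε_a = 0`. -/
def homogData : HomogData A ℂ where
  comp Δ := K.H.eigenspace Δ
  wt Δ := Δ
  ε _ := 0
  deg n Δ Δ' := Δ + Δ' - n - 1
  vacDeg := 0
  P := K.prodV
  P_eventually_zero := K.prodV_eventually_zero
  P_of_mem n _ _ ha := K.prodV_of_mem n ha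
  comp_super _ := A.isSubSuperspace_of_parityProj fun α _ => K.parityProj_mem_eigenspace α
  iSup_comp := K.iSup_eigenspace
  nth_mem n _ _ _ _ := K.nth_mem_eigenspace n
  vac_mem := K.vac_mem_eigenspace
  wt_vacDeg := rfl
  ε_vacDeg := rfl
  ε_nonpos _ := le_rfl
  neg_one_lt_ε _ := by norm_num
  wt_deg n μ ν := by simp [chi]
  ε_deg n μ ν := by simp [chi]

theorem homogData_VG : K.homogData.VG = ⊤ :=
  Hb.span_incl _ (internal_induction K.diagonalizable
    (S := (K.homogData.VG.restrictScalars ℂ).comap incl)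
    fun Δ _ ha => K.homogData.incl_mem_VG (μ := Δ) rfl ha)

/-- The generators of `K.J` use arbitrary `a` and `b`; bilinearity and diagonalizability reduce to
eigenvectors. -/
theorem prod_incl_mem_homogData_J {n : ℤ} (hn : n ≤ -2) (a b : V) :
    K.prod n (incl a) (incl b) ∈ K.homogData.J := by
  refine internal_induction K.diagonalizable (S := (K.homogData.J.restrictScalars ℂ).comap
    (((K.prodV n).flip b))) (fun Δ a ha => ?_) a |> fun h => (K.homogData.prod_incl n a b ▸ h)
  refine internal_induction K.diagonalizable (S := (K.homogData.J.restrictScalars ℂ).comap (K.prodV n a))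
    (fun Δ' b hb => ?_) b
  exact K.homogData.P_mem_J (K.homogData.balanced_of_eq_zero (μ := Δ) (ν := Δ') rfl rfl) ha hb
    (by rwa [K.homogData.χ_of_left rfl])

theorem homogData_J : K.homogData.J = K.J := by
  apply le_antisymm
  · refine Submodule.span_mono ?_
    rintro _ ⟨μ, ν, _, a, _, b, _, rfl⟩
    exact ⟨a, b, by rw [K.homogData.χ_of_left rfl]; rfl⟩
  · refine Submodule.span_le.2 ?_
    rintro _ ⟨a, b, rfl⟩
    exact K.prod_incl_mem_homogData_J le_rfl a b

theorem TH_incl (a : V) :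
    K.TH (incl a) = incl (A.T a) + (Polynomial.X : ℂ[X]) • incl (K.H a) := by
  simp [TH, incl]

theorem TH_incl_mem_J (a : V) : K.TH (incl a) ∈ K.J := by
  refine internal_induction K.diagonalizable (S := (K.J.restrictScalars ℂ).comap
    (K.TH.restrictScalars ℂ ∘ₗ incl)) (fun Δ a ha => ?_) a
  show K.TH (incl a) ∈ K.J
  rw [TH_incl, Module.End.mem_eigenspace_iff.1 ha, map_smul, ← homogData_J]
  exact K.homogData.T_add_smul_mem_J (μ := Δ) rfl ha

end Hamiltonian

/-! ### Arithmetic of `ε`. -/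

section Eps

variable {Γ : AddSubgroup ℝ}

theorem eps_nonpos (hΓ : AddSubgroup.zmultiples (1 : ℝ) ≤ Γ) (γ : ModZ Γ) (Δ : ℝ) :
    eps γ Δ ≤ 0 := (isGreatest_eps hΓ γ Δ).1.1

theorem intCast_mem (hΓ : AddSubgroup.zmultiples (1 : ℝ) ≤ Γ) (k : ℤ) : (k : ℝ) ∈ Γ :=
  hΓ (AddSubgroup.mem_zmultiples_iff.mpr ⟨k, by simp⟩)

theorem mk_eq_mk_iff (g g' : Γ) : (QuotientAddGroup.mk g : ModZ Γ) = QuotientAddGroup.mk g' ↔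
    ∃ k : ℤ, (k : ℝ) = g' - g := by
  rw [QuotientAddGroup.eq, AddSubgroup.mem_addSubgroupOf, AddSubgroup.mem_zmultiples_iff]
  simp only [zsmul_eq_mul, mul_one, neg_add_eq_sub, AddSubgroup.coe_sub]

theorem neg_one_lt_eps (hΓ : AddSubgroup.zmultiples (1 : ℝ) ≤ Γ) (γ : ModZ Γ) (Δ : ℝ) :
    -1 < eps γ Δ := by
  by_contra! h
  obtain ⟨⟨_, g, hg, hx⟩, hmax⟩ := isGreatest_eps hΓ γ Δ
  have h1 : eps γ Δ + 1 ≤ eps γ Δ := hmax ⟨by linarith,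
    g + ⟨((1 : ℤ) : ℝ), intCast_mem hΓ 1⟩, by
      rw [← hg, mk_eq_mk_iff]
      exact ⟨-1, by simp⟩, by rw [hx]; simp; ring⟩
  linarith

/-- A coset of `ℤ` has at most one element in `(-1, 0]`, and `ε` lies there. -/
theorem eps_eq_of_mk (hΓ : AddSubgroup.zmultiples (1 : ℝ) ≤ Γ) {γ : ModZ Γ} {Δ x : ℝ}
    (hx : x ≤ 0) (hx' : -1 < x) {g : Γ} (hg : (QuotientAddGroup.mk g : ModZ Γ) = γ)
    (h : x = g - Δ) : eps γ Δ = x := by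
  have h1 := eps_nonpos hΓ γ Δ
  have h2 := neg_one_lt_eps hΓ γ Δ
  obtain ⟨⟨_, g', hg', h'⟩, _⟩ := isGreatest_eps hΓ γ Δ
  obtain ⟨k, hk⟩ := (mk_eq_mk_iff g g').1 (hg.trans hg'.symm)
  have h3 : (k : ℝ) < 1 := by linarith
  have h4 : (-1 : ℝ) < k := by linarith
  have h3' : k < 1 := by exact_mod_cast h3
  have h4' : -1 < k := by exact_mod_cast h4
  obtain rfl : k = 0 := by omega
  rw [Int.cast_zero] at hk
  linarith

theorem eps_zero (hΓ : AddSubgroup.zmultiples (1 : ℝ) ≤ Γ) : eps (0 : ModZ Γ) 0 = 0 :=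
  eps_eq_of_mk hΓ le_rfl (by norm_num) (g := 0) rfl (by simp)

/-- The sum `ε_a + ε_b` lies in the right coset and in `(-2, 0]`; adding `χ` brings it into `(-1,
0]`. The shift by `n + 1` is an integer and does not matter. -/
theorem eps_add (hΓ : AddSubgroup.zmultiples (1 : ℝ) ≤ Γ) (n : ℤ) (γ γ' : ModZ Γ) (Δ Δ' : ℝ) :
    eps (γ + γ') (Δ + Δ' - n - 1) = eps γ Δ + eps γ' Δ' + chi (eps γ Δ) (eps γ' Δ') := by
  obtain ⟨⟨h1, g, hg, h⟩, _⟩ := isGreatest_eps hΓ γ Δ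
  obtain ⟨⟨h1', g', hg', h'⟩, _⟩ := isGreatest_eps hΓ γ' Δ'
  have h2 := neg_one_lt_eps hΓ γ Δ
  have h2' := neg_one_lt_eps hΓ γ' Δ'
  set k := chi (eps γ Δ) (eps γ' Δ') with hk
  refine eps_eq_of_mk hΓ ?_ ?_
    (g := g + g' + ⟨((k - n - 1 : ℤ) : ℝ), intCast_mem hΓ _⟩) ?_ ?_
  · rw [hk, chi]
    split_ifs <;> push_cast <;> linarith
  · rw [hk, chi]
    split_ifs <;> push_cast <;> linarith
  · rw [← hg, ← hg', ← QuotientAddGroup.mk_add, mk_eq_mk_iff]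
    exact ⟨-(k - n - 1), by simp⟩
  · rw [h, h']
    simp
    ring

end Eps

/-! ### Gradings by `Γ/ℤ`. -/

namespace TwistGrading

variable {A : VertexAlgebra V} {K : Hamiltonian A} {Γ : AddSubgroup ℝ} (G : TwistGrading K Γ)

/-- The degree-zero component of the vacuum is again a left identity for the `(-1)`-product.
Applying it to the vacuum, a right identity, shows that it equals the vacuum. -/
theorem vac_mem_piece : A.vac ∈ G.piece 0 := by
  classical
  have hint : DirectSum.IsInternal G.piece := by convert G.internal
  set pr := internalProj hint with hpr'
  have hpr : ∀ γ δ : ModZ Γ, ∀ a ∈ G.piece δ, pr γ a = if δ = γ then a else 0 :=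
    fun γ δ a ha => internalProj_of_mem hint γ ha
  have h1 : ∀ β, ∀ b ∈ G.piece β, ∀ v, pr β (A.nth (-1) v b) = A.nth (-1) (pr 0 v) b := by
    intro β b hb v
    refine sub_eq_zero.1 (internal_induction hint (S := LinearMap.ker
      (pr β ∘ₗ (A.nth (-1)).flip b - (A.nth (-1)).flip b ∘ₗ pr 0)) (fun γ a ha => ?_) v)
    rw [LinearMap.mem_ker]
    show pr β (A.nth (-1) a b) - A.nth (-1) (pr 0 a) b = 0
    rw [hpr β _ _ (G.nth_mem (-1) ha hb), hpr 0 γ a ha]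
    simp only [add_eq_right]
    split_ifs <;> simp
  have h2 : ∀ b, b ∈ LinearMap.ker (A.nth (-1) (pr 0 A.vac) - LinearMap.id) := by
    refine internal_induction hint fun β b hb => ?_
    rw [LinearMap.mem_ker]
    show A.nth (-1) (pr 0 A.vac) b - b = 0
    rw [← h1 β b hb, A.nth_vac_left, if_pos rfl, hpr β β b hb, if_pos rfl, sub_self]
  have h3 : A.nth (-1) (pr 0 A.vac) A.vac = A.vac := sub_eq_zero.1 (h2 A.vac)
  rw [A.nth_vac_right _ le_rfl, if_pos rfl] at h3
  rw [← h3]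
  exact internalProj_mem hint 0 _

/-- The projection to a piece commutes with `H`, so it carries the weight decomposition of `V` to
one of the piece; non-real weights contribute nothing. -/
theorem piece_le_iSup_comp (γ : ModZ Γ) : G.piece γ ≤ ⨆ Δ : ℝ, G.comp γ Δ := by
  classical
  have hint : DirectSum.IsInternal G.piece := by convert G.internal
  intro a ha
  have h := internal_induction K.diagonalizable
    (S := (⨆ Δ : ℝ, G.comp γ Δ).comap (internalProj hint γ)) (fun Δ x hx => ?_) a
  · rwa [Submodule.mem_comap, internalProj_of_mem hint γ ha, if_pos rfl] at h
  · rw [Submodule.mem_comap]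
    have hx' : internalProj hint γ x ∈ K.H.eigenspace Δ := by
      rw [Module.End.mem_eigenspace_iff] at hx ⊢
      rw [internalProj_comm hint (fun _ _ h => G.H_mem h), hx, map_smul]
    by_cases hΔ : K.H.HasEigenvalue Δ
    · have : ((Δ.re : ℝ) : ℂ) = Δ := Complex.ext rfl (G.real_weights Δ hΔ).symm
      exact Submodule.mem_iSup_of_mem Δ.re ⟨internalProj_mem hint γ x, by rwa [this]⟩
    · have : K.H.eigenspace Δ = ⊥ := by
        by_contra hne
        exact hΔ hne
      rw [this, Submodule.mem_bot] at hx'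
      rw [hx']
      exact Submodule.zero_mem _

theorem iSup_comp : ⨆ μ : ModZ Γ × ℝ, G.comp μ.1 μ.2 = ⊤ := by
  classical
  have hint : DirectSum.IsInternal G.piece := by convert G.internal
  rw [iSup_prod, eq_top_iff, ← hint.submodule_iSup_eq_top]
  exact iSup_mono G.piece_le_iSup_comp

/-- The homogeneous vectors of a `Γ/ℤ`-graded vertex algebra. -/
def homogData : HomogData A (ModZ Γ × ℝ) where
  comp μ := G.comp μ.1 μ.2
  wt μ := ((μ.2 + eps μ.1 μ.2 : ℝ) : ℂ)
  ε μ := eps μ.1 μ.2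
  deg n μ ν := (μ.1 + ν.1, μ.2 + ν.2 - n - 1)
  vacDeg := (0, 0)
  P := G.prodV
  P_eventually_zero := G.prodV_eventually_zero
  P_of_mem n _ _ ha := G.prodV_of_mem n ha
  comp_super _ := A.isSubSuperspace_of_parityProj fun α _ ha =>
    ⟨(G.super _).parityProj_mem α ha.1, K.parityProj_mem_eigenspace α ha.2⟩
  iSup_comp := G.iSup_comp
  nth_mem n _ _ _ _ ha hb := ⟨G.nth_mem n ha.1 hb.1, by
    simpa using K.nth_mem_eigenspace n ha.2 hb.2⟩
  vac_mem := ⟨G.vac_mem_piece, by simpa using K.vac_mem_eigenspace⟩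
  wt_vacDeg := by simp [eps_zero G.int_le]
  ε_vacDeg := eps_zero G.int_le
  ε_nonpos _ := eps_nonpos G.int_le _ _
  neg_one_lt_ε _ := neg_one_lt_eps G.int_le _ _
  wt_deg n μ ν := by
    simp only
    rw [eps_add G.int_le]
    push_cast
    ring
  ε_deg n μ ν := eps_add G.int_le n _ _ _ _

theorem homogData_VG : G.VG = G.homogData.VG := by
  refine congrArg (Submodule.span ℂ[X]) (Set.ext fun x => ?_)
  exact ⟨fun ⟨γ, Δ, h⟩ => ⟨(γ, Δ), h⟩, fun ⟨μ, h⟩ => ⟨μ.1, μ.2, h⟩⟩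

theorem homogData_J : G.J = G.homogData.J := by
  refine congrArg (Submodule.span ℂ[X]) (Set.ext fun x => ?_)
  exact ⟨fun ⟨γ, γ', Δ, Δ', h⟩ => ⟨(γ, Δ), (γ', Δ'), h⟩,
    fun ⟨μ, ν, h⟩ => ⟨μ.1, ν.1, μ.2, ν.2, h⟩⟩

theorem prod_eq_of_mem_VG (n : ℤ) {x : Hb V} (hx : x ∈ G.VG) (y : Hb V) :
    G.prod n x y = K.prod n x y := by
  have h : G.VG ≤ LinearMap.ker ((G.prod n).flip y - (K.prod n).flip y) := by
    refine Submodule.span_le.2 ?_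
    rintro _ ⟨γ, Δ, hε, a, ha, rfl⟩
    rw [SetLike.mem_coe, LinearMap.mem_ker, LinearMap.sub_apply, sub_eq_zero]
    show bilinExt (G.prodV n) (incl a) y = bilinExt (K.prodV n) (incl a) y
    rw [bilinExt_incl_left, bilinExt_incl_left, G.prodV_of_mem n ha, K.prodV_of_mem n ha.2, hε,
      add_zero]
  exact sub_eq_zero.1 (h hx)

theorem TH_mem_J {x : Hb V} (hx : x ∈ G.VG) : K.TH x ∈ G.J := by
  have h : G.VG ≤ G.J.comap K.TH := by
    refine Submodule.span_le.2 ?_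
    rintro _ ⟨γ, Δ, hε, a, ha, rfl⟩
    have := G.homogData.T_add_smul_mem_J (μ := (γ, Δ)) hε ha
    rw [SetLike.mem_coe, Submodule.mem_comap, K.TH_incl, Module.End.mem_eigenspace_iff.1 ha.2,
      map_smul, homogData_J]
    have hwt : G.homogData.wt (γ, Δ) = Δ := by
      show ((Δ + eps γ Δ : ℝ) : ℂ) = Δ
      rw [hε, add_zero]
    rwa [hwt] at this
  exact h hx

end TwistGrading

theorem Hamiltonian.exists_zhu {A : VertexAlgebra V} (K : Hamiltonian A) :
    ∃ mul : K.Zhu → K.Zhu → K.Zhu,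
      (∀ x y : Hb V, mul (K.J.mkQ x) (K.J.mkQ y) = K.J.mkQ (K.prod (-1) x y)) ∧
      IsSuperalgebra mul (K.J.mkQ (incl A.vac)) fun α => (A.parityHb α).map K.J.mkQ := by
  have hV : ∀ x : Hb V, x ∈ K.homogData.VG := fun x => K.homogData_VG ▸ Submodule.mem_top
  have hl : ∀ v, ∀ x ∈ K.J, K.prod (-1) v x ∈ K.J := by
    rw [← K.homogData_J]
    exact fun v x hx => K.homogData.prod_mem_J_left hx (hV v)
  have hr : ∀ x ∈ K.J, ∀ v, K.prod (-1) x v ∈ K.J := by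
    rw [← K.homogData_J]
    exact fun x hx v => K.homogData.prod_mem_J_right hx (hV v)
  refine ⟨_, fun x y => quotientMul_mk (K.prod (-1)) K.J hl hr x y, isSuperalgebra_quotient
    (K.prod (-1)) K.J (incl A.vac) A.parityHb A.parityProjHb hl hr K.homogData.prod_vac_left
    K.homogData.prod_vac_right ?_ (A.incl_mem_parityHb A.vac_even)
    (fun hx hy => K.homogData.prod_mem_parityHb (-1) hx hy) A.parityProjHb_mem
    (fun α β x hx => A.parityProjHb_of_mem α hx) A.sum_parityProjHb ?_⟩
  · rw [← K.homogData_J]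
    exact fun x y z => K.homogData.assoc_mem_J (hV x) (hV y) (hV z)
  · rw [← K.homogData_J]
    exact fun α x hx => K.homogData.parityProjHb_mem_J α hx

end

end ZhuAlg

theorem mainTheorem9 {V : Type u} [AddCommGroup V] [Module ℂ V] (A : VertexAlgebra V)
    (K : Hamiltonian A) :
    -- the `ħ`-deformation
    ((∀ j : ℤ, 2 ≤ j → ∀ a b : V, K.prod (-j) (incl a) (incl b) ∈ K.J) ∧
      (∀ a : V, K.TH (incl a) ∈ K.J) ∧
      (∀ x ∈ K.J, ∀ v : Hb V, K.prod (-1) x v ∈ K.J ∧ K.prod (-1) v x ∈ K.J) ∧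
      (∀ x ∈ K.J, ∀ v : Hb V, (Polynomial.X : ℂ[X]) • K.bracket x v ∈ K.J ∧
        (Polynomial.X : ℂ[X]) • K.bracket v x ∈ K.J) ∧
      (∀ x : Hb V, K.prod (-1) (incl A.vac) x = x ∧ K.prod (-1) x (incl A.vac) = x) ∧
      (∀ α β : ZMod 2, ∀ x ∈ A.parityHb α, ∀ y ∈ A.parityHb β,
        K.prod (-1) x y - sgn α β • K.prod (-1) y x - (Polynomial.X : ℂ[X]) • K.bracket x y
          ∈ K.J) ∧
      (∀ x y z : Hb V,
        K.prod (-1) (K.prod (-1) x y) z - K.prod (-1) x (K.prod (-1) y z) ∈ K.J) ∧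
      (∃ mul : K.Zhu → K.Zhu → K.Zhu,
        (∀ x y : Hb V, mul (K.J.mkQ x) (K.J.mkQ y) = K.J.mkQ (K.prod (-1) x y)) ∧
        IsSuperalgebra mul (K.J.mkQ (incl A.vac)) fun α => (A.parityHb α).map K.J.mkQ)) ∧
    -- the `(ħ,Γ)`-deformation
    (∀ (Γ : AddSubgroup ℝ) (G : TwistGrading K Γ),
      G.J ≤ G.VG ∧
      incl A.vac ∈ G.VG ∧
      (∀ x ∈ G.VG, ∀ y ∈ G.VG, G.prod (-1) x y ∈ G.VG ∧ G.prod (-1) x y = K.prod (-1) x y ∧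
        G.bracket x y ∈ G.VG) ∧
      (∀ j : ℤ, 2 ≤ j → ∀ (γ₁ γ₂ : ModZ Γ) (Δ₁ Δ₂ : ℝ),
        (∃ k : ℤ, eps γ₁ Δ₁ + eps γ₂ Δ₂ = k) → ∀ a ∈ G.comp γ₁ Δ₁, ∀ b ∈ G.comp γ₂ Δ₂,
        G.prod (-j + chi (eps γ₁ Δ₁) (eps γ₂ Δ₂)) (incl a) (incl b) ∈ G.J) ∧
      (∀ x ∈ G.VG, K.TH x ∈ G.J) ∧
      (∀ x ∈ G.J, ∀ v ∈ G.VG, G.prod (-1) x v ∈ G.J ∧ G.prod (-1) v x ∈ G.J) ∧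
      (∀ x ∈ G.J, ∀ v ∈ G.VG, (Polynomial.X : ℂ[X]) • G.bracket x v ∈ G.J ∧
        (Polynomial.X : ℂ[X]) • G.bracket v x ∈ G.J) ∧
      (∀ x : Hb V, G.prod (-1) (incl A.vac) x = x ∧ G.prod (-1) x (incl A.vac) = x) ∧
      (∀ (γ₁ γ₂ : ModZ Γ) (Δ₁ Δ₂ : ℝ), (∃ k : ℤ, eps γ₁ Δ₁ + eps γ₂ Δ₂ = k) →
        ∀ α β : ZMod 2, ∀ a ∈ G.comp γ₁ Δ₁ ⊓ A.parity α, ∀ b ∈ G.comp γ₂ Δ₂ ⊓ A.parity β,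
        G.prod (-1) (incl a) (incl b) - sgn α β • G.prod (-1) (incl b) (incl a)
          - ((1 - chi (eps γ₁ Δ₁) (eps γ₂ Δ₂) : ℤ) : ℂ) •
            (Polynomial.X : ℂ[X]) • G.bracket (incl a) (incl b) ∈ G.J) ∧
      (∀ x ∈ G.VG, ∀ y ∈ G.VG, ∀ z ∈ G.VG,
        G.prod (-1) (G.prod (-1) x y) z - G.prod (-1) x (G.prod (-1) y z) ∈ G.J) ∧
      (∃ (mul : G.Zhu → G.Zhu → G.Zhu) (one : G.Zhu),
        (∀ x y z : G.VG, (z : Hb V) = G.prod (-1) x y →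
          mul ((G.J.submoduleOf G.VG).mkQ x) ((G.J.submoduleOf G.VG).mkQ y)
            = (G.J.submoduleOf G.VG).mkQ z) ∧
        (∀ u : G.VG, (u : Hb V) = incl A.vac → (G.J.submoduleOf G.VG).mkQ u = one) ∧
        IsSuperalgebra mul one fun α =>
          ((A.parityHb α).submoduleOf G.VG).map (G.J.submoduleOf G.VG).mkQ)) := by
  have hV : ∀ x : Hb V, x ∈ K.homogData.VG := fun x => K.homogData_VG ▸ Submodule.mem_top
  have hP : K.prod = K.homogData.prod := rfl
  have hB : K.bracket = K.homogData.bracket := rfl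
  refine ⟨⟨fun j hj a b => ?_, K.TH_incl_mem_J, fun x hx v => ?_, fun x hx v => ?_,
    fun x => ⟨K.homogData.prod_vac_left x, K.homogData.prod_vac_right x⟩,
    fun α β x hx y hy => ?_, fun x y z => ?_, K.exists_zhu⟩, fun Γ G => ?_⟩
  · rw [← K.homogData_J]
    exact K.prod_incl_mem_homogData_J (by omega) a b
  · rw [← K.homogData_J] at hx ⊢
    exact ⟨K.homogData.prod_mem_J_right hx (hV v), K.homogData.prod_mem_J_left hx (hV v)⟩
  · rw [← K.homogData_J] at hx ⊢
    exact ⟨K.homogData.bracket_mem_J_right hx (hV v), K.homogData.bracket_mem_J_left hx (hV v)⟩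
  · rw [← K.homogData_J]
    exact K.homogData.skew_mem_J_of_mem_VGParity (K.homogData.mem_VGParity (hV x) hx)
      (K.homogData.mem_VGParity (hV y) hy)
  · rw [← K.homogData_J]
    exact K.homogData.assoc_mem_J (hV x) (hV y) (hV z)
  · refine ⟨?_, ?_, fun x hx y hy => ⟨?_, G.prod_eq_of_mem_VG _ hx y, ?_⟩,
      fun j hj γ₁ γ₂ Δ₁ Δ₂ hk a ha b hb => ?_, fun x hx => G.TH_mem_J hx, fun x hx v hv => ?_,
      fun x hx v hv => ?_,
      fun x => ⟨G.homogData.prod_vac_left x, G.homogData.prod_vac_right x⟩,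
      fun γ₁ γ₂ Δ₁ Δ₂ hk α β a ha b hb => ?_, fun x hx y hy z hz => ?_,
      G.homogData.exists_zhu G.homogData_J G.homogData_VG⟩
    · rw [G.homogData_J, G.homogData_VG]
      exact G.homogData.J_le_VG
    · rw [G.homogData_VG]
      exact G.homogData.vac_mem_VG
    · rw [G.homogData_VG] at *
      exact G.homogData.prod_mem_VG (-1) hx hy
    · rw [G.homogData_VG] at *
      exact G.homogData.bracket_mem_VG hx hy
    · rw [G.homogData_J, show G.prod = G.homogData.prod from rfl, G.homogData.prod_incl]
      exact G.homogData.P_mem_J (μ := (γ₁, Δ₁)) (ν := (γ₂, Δ₂)) hk ha hb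
        (add_le_add_left (by omega) _)
    · rw [G.homogData_J] at *
      rw [G.homogData_VG] at hv
      exact ⟨G.homogData.prod_mem_J_right hx hv, G.homogData.prod_mem_J_left hx hv⟩
    · rw [G.homogData_J] at *
      rw [G.homogData_VG] at hv
      exact ⟨G.homogData.bracket_mem_J_right hx hv, G.homogData.bracket_mem_J_left hx hv⟩
    · rw [G.homogData_J]
      exact G.homogData.skew_mem_J (μ := (γ₁, Δ₁)) (ν := (γ₂, Δ₂)) hk ha.1 ha.2 hb.1 hb.2
    · rw [G.homogData_VG] at *
      rw [G.homogData_J]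
      exact G.homogData.assoc_mem_J hx hy hz
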